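/- **Theorem (Abstract fully discrete error bound).** Let $\Omega\subset\mathbb R^d$ be open, let $N\ge 1$, $\tau>0$, $t^n=n\tau$, and write $\|\cdot\|$, $(\cdot,\cdot)$ for the norm and inner product of $L^2(\Omega)$ (vectors or tensors, with the Euclidean/Frobenius norm pointwise). *Continuous problem.* Let $\mathbb C=(C_{ijkl})$ be a stiffness tensor field on $\Omega$ with $C_{ijkl}=C_{jikl}=C_{ijlk}=C_{klij}$ and $\sum C_{ijkl}\gamma_{kl}\gamma_{ij}\ge c_*\sum\gamma_{ij}^2$ for all symmetric $\gamma$, where $c_*>0$; put $\varepsilon(v)=\frac12(\nabla v+\nabla v^T)$, $\sigma(v)=\mathbb C\varepsilon(v)$, $a(u,v)=\int_\Omega\sigma(u):\varepsilon(v)\,dx$. Let $C_{F\Omega}$ be a constant with $\|v\|\le C_{F\Omega}\|\nabla v\|$ for all $v\in H^1_0(\Omega)^d$. Let $f\in L^2(0,t^N;L^2(\Omega)^d)$ have values $f(t)$ at every time $t$, let $u_0\in H^1_0(\Omega)^d$, $u_1\in L^2(\Omega)^d$, and let $u\in L^2(0,t^N;H^1_0(\Omega)^d)$ with $\partial_tu\in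 L^2(0,t^N;L^2(\Omega)^d)$ be a weak solution of $$(\partial_{tt}^2u,v)+a(u,v)=(f,v)\quad\forall v\in H^1_0(\Omega)^d,\ \text{a.e. in }(0,t^N),\qquad u(0)=u_0,\ \partial_tu(0)=u_1 .$$ *Discretization.* For $n=0,\dots,N$ let $\mathcal T_h^n$ be a finite subdivision of $\Omega$ into disjoint open convex polytopes without hanging nodes, on each element of which $\mathbb C$ is constant; $V_h^n$ is the space of fields that are polynomials of total degree at most $r$ in each component on each element, $\Pi_h^n$ the $L^2$-orthogonal projection onto $V_h^n$, and $$a_h^n(u,v)=\sum_K\int_K\sigma(u):\varepsilon(v)-\sum_e\int_e\{\sigma(u)\nu_e\}\cdot[v]-\sum_e\int_e\{\sigma(v)\nu_e\}\cdot[u]+\sum_e\int_e\alpha\mathsf h^{-1}[u]\cdot[v],$$ where $K$ runs through the elements and $e$ through the faces of $\mathcal T_h^n$, $\alpha>0$, $\mathsf h$ is the minimum of the diameters of the elements adjacent to $e$, $\nu_e$ points from $K^+$ to $K^-$ (outwards on $\partial\Omega$), and on interior faces $\{q\}=\frac12(q^++q^-)$, $[q]=q^+-q^-$, on boundary faces $\{q\}=[q]=q$.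 For a sequence $(x^n)$ with a given value $\partial x^0$ put $\partial x^n=(x^n-x^{n-1})/\tau$ and $\partial^2x^n=(\partial x^n-\partial x^{n-1})/\tau$ for $n\ge 1$. Let $u_h^n\in V_h^n$ satisfy $u_h^0=\Pi_h^0u_0$, $\partial u_h^0=\Pi_h^0u_1$ and $$(\partial^2u_h^n,v)+a_h^n(u_h^n,v)=(f(t^n),v)\qquad\forall v\in V_h^n,\ n=1,\dots,N .$$ *Reconstructions.* Let $B^n:V_h^n\to V_h^n$, $(B^nz,v)=a_h^n(z,v)$ for all $v\in V_h^n$; $\tilde f^0=f(0)$, $\tilde f^n=\tau^{-1}\int_{t^{n-1}}^{t^n}f\,dt$; $g^n=B^nu_h^n-\Pi_h^nf(t^n)+\tilde f^n$ and $\partial g^0=B^0\partial u_h^0-\Pi_h^0f(0)+f(0)$. Let $w^n,\partial w^0\in H^1_0(\Omega)^d$ be the stationary-elasticity reconstructions: $a(w^n,v)=(g^n,v)$ and $a(\partial w^0,v)=(\partial g^0,v)$ for all $v\in H^1_0(\Omega)^d$. For $t\in(t^{n-1},t^n]$ let $$u_N(t)=\tfrac{t-t^{n-1}}{\tau}u_h^n+\tfrac{t^n-t}{\tau}u_h^{n-1}-\tfrac{(t-t^{n-1})(t^n-t)^2}{\tau}\partial^2u_h^n,\quad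 u_N(0)=u_h^0,$$ define $w_N$ in the same way from $(w^n)$ and $\partial w^0$, and put $e_N=u_N-u$, $\theta_N=w_N-u_N$. *Indicators.* With $\mu^n(t)=-6\tau^{-1}\bigl(t-\frac{t^n+t^{n-1}}2\bigr)$, $\gamma_0=0$, $\gamma_n=\gamma_{n-1}+\frac{\tau^2}2\partial g^n+\frac{\tau^3}{12}\partial^2g^n$ and, on $(t^{n-1},t^n]$, $\mathcal G(t)=\frac{(t^n-t)^2}2\partial g^n-\bigl(\frac{(t^n-t)^4}{4\tau}-\frac{(t^n-t)^3}3\bigr)\partial^2g^n-\gamma_n$, let $$\zeta_{MC}=\sum_{n=1}^N\int_{t^{n-1}}^{t^n}\|(I-\Pi_h^n)\partial_tu_N\|\,dt+\sum_{n=0}^{N-1}(t^N-t^n)\|(\Pi_h^{n+1}-\Pi_h^n)\partial u_h^n\|,\qquad \zeta_{evo}=\int_0^{t^N}\|\mathcal G\|\,dt,$$ $$\zeta_{osc}=\frac1{2\pi}\sum_{n=1}^N\Bigl(\int_{t^{n-1}}^{t^n}\tau^3\|\tilde f^n-f\|^2dt\Bigr)^{1/2},\qquad \zeta_{T.Rec}=\frac1{2\pi}\sum_{n=1}^N\Bigl(\int_{t^{n-1}}^{t^n}\tau^3\|\mu^n\partial^2u_h^n\|^2dt\Bigr)^{1/2}.$$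 Then $$\|e_N\|_{L^\infty(0,t^N;L^2)}\le\|\theta_N\|_{L^\infty(0,t^N;L^2)}+\sqrt2\|\theta_N(0)\|+2\int_0^{t^N}\|\partial_t\theta_N\|\,dt+2(\zeta_{MC}+\zeta_{evo}+\zeta_{osc}+\zeta_{T.Rec})+\sqrt2\|u_0-u_h^0\|+2C_{F\Omega}c_*^{-1/2}\|u_1-\partial u_h^0\| .$$ -/

import Mathlib

open MeasureTheory Set
open scoped ContDiff InnerProductSpace

noncomputable section

namespace ElastoDG

/-! ### Function spaces -/

/-- Euclidean space `ℝ^d`. -/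
abbrev E (d : ℕ) := EuclideanSpace ℝ (Fin d)

/-- Second order tensors with the norm `|σ| = √(σ : σ)`. -/
abbrev Ten (d : ℕ) := EuclideanSpace ℝ (Fin d × Fin d)

/-- `L²(Ω)^d`. -/
abbrev L2v {d : ℕ} (Ω : Set (E d)) := Lp (E d) 2 (volume.restrict Ω)

/-- `L²(Ω)^{d × d}`. -/
abbrev L2t {d : ℕ} (Ω : Set (E d)) := Lp (Ten d) 2 (volume.restrict Ω)

/-- Pairs (function, gradient). An element of `H¹` is represented by the pair `(v, ∇v)`. The product
norm is equivalent to the `H¹` norm. -/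
abbrev GradPair {d : ℕ} (Ω : Set (E d)) := L2v Ω × L2t Ω

/-- The pairs `(φ, ∇φ)` with `φ ∈ C_c^∞(Ω)^d`; the gradient has the entries `∂_j φ_i` at `(i, j)`. -/
def testPairs {d : ℕ} (Ω : Set (E d)) : Set (GradPair Ω) :=
  {p | ∃ φ : E d → E d, ContDiff ℝ ∞ φ ∧ HasCompactSupport φ ∧ tsupport φ ⊆ Ω ∧
    p.1 =ᵐ[volume.restrict Ω] φ ∧
    p.2 =ᵐ[volume.restrict Ω] fun x =>
      WithLp.toLp 2 fun ij : Fin d × Fin d => (fderiv ℝ φ x (EuclideanSpace.single ij.2 1)) ij.1}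

/-- `H¹₀(Ω)^d`, the closure of `C_c^∞(Ω)^d` in `H¹(Ω)^d`. Its elements are the pairs `(v, ∇v)`. -/
def H10 {d : ℕ} (Ω : Set (E d)) : Submodule ℝ (GradPair Ω) :=
  (Submodule.span ℝ (testPairs Ω)).topologicalClosure

/-! ### Elasticity -/

/-- Fourth order tensors `C_{ijkl}`. -/
abbrev Ten4 (d : ℕ) := Fin d → Fin d → Fin d → Fin d → ℝ

/-- `(c A) : B = ∑ c_{ijkl} A_{kl} B_{ij}`. -/
def contract {d : ℕ} (c : Ten4 d) (A B : Fin d → Fin d → ℝ) : ℝ :=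
  ∑ i, ∑ j, ∑ k, ∑ l, c i j k l * A k l * B i j

/-- The symmetric part of a matrix; of a gradient it is the strain `ε`. -/
def symPart {d : ℕ} (M : Fin d → Fin d → ℝ) : Fin d → Fin d → ℝ :=
  fun i j => (M i j + M j i) / 2

/-- A symmetric stiffness tensor field on `Ω`, positive definite with constant `cstar`. -/
structure IsStiffness {d : ℕ} (Ω : Set (E d)) (C : E d → Ten4 d) (cstar : ℝ) : Prop where
  symm_left : ∀ x ∈ Ω, ∀ i j k l, C x i j k l = C x j i k l
  symm_right : ∀ x ∈ Ω, ∀ i j k l, C x i j k l = C x i j l k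
  symm_major : ∀ x ∈ Ω, ∀ i j k l, C x i j k l = C x k l i j
  pos : 0 < cstar
  coercive : ∀ x ∈ Ω, ∀ γ : Fin d → Fin d → ℝ, (∀ i j, γ i j = γ j i) →
    cstar * ∑ i, ∑ j, γ i j ^ 2 ≤ contract (C x) γ γ

/-- `a(u, v) = ∫_Ω σ(u) : ε(v)`. -/
def elasticForm {d : ℕ} {Ω : Set (E d)} (C : E d → Ten4 d) (u v : GradPair Ω) : ℝ :=
  ∫ x in Ω, contract (C x) (symPart fun i j => u.2 x (i, j)) (symPart fun i j => v.2 x (i, j))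

/-- `w` is the element of `H¹₀(Ω)^d` with `a(w, v) = (g, v)` for all `v ∈ H¹₀(Ω)^d`. -/
def SolvesSE {d : ℕ} {Ω : Set (E d)} (C : E d → Ten4 d) (g : L2v Ω) (w : GradPair Ω) : Prop :=
  w ∈ H10 Ω ∧ ∀ v ∈ H10 Ω, elasticForm C w v = ⟪g, v.1⟫_ℝ

/-- Weak solutions of `∂²ₜₜ u - ∇·σ(u) = f` in `(0,T) × Ω` with `u = 0` on `∂Ω`, `u(0) = u₀`,
`∂ₜu(0) = u₁`: one has `u ∈ L²(0,T; H¹₀)`, `∂ₜu = u' ∈ L²(0,T; L²)`, and for every `v ∈ H¹₀` the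
function `(u', v)` is absolutely continuous (up to a null set of times) with initial value `(u₁, v)`
and a.e. derivative `(f, v) - a(u, v)`. -/
structure IsWeakSolution {d : ℕ} {Ω : Set (E d)} (C : E d → Ten4 d) (T : ℝ) (f : ℝ → L2v Ω)
    (u₀ : GradPair Ω) (u₁ : L2v Ω) (u : ℝ → GradPair Ω) : Prop where
  mem_H10 : ∀ᵐ t ∂volume.restrict (Ioo 0 T), u t ∈ H10 Ω
  memLp : MemLp u 2 (volume.restrict (Ioo 0 T))
  weak : ∃ u' : ℝ → L2v Ω, MemLp u' 2 (volume.restrict (Ioo 0 T)) ∧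
    (∀ t ∈ Icc 0 T, (u t).1 = u₀.1 + ∫ s in (0 : ℝ)..t, u' s) ∧
    ∀ v ∈ H10 Ω, ∀ᵐ t ∂volume.restrict (Ioo 0 T),
      ⟪u' t, v.1⟫_ℝ = ⟪u₁, v.1⟫_ℝ + ∫ s in (0 : ℝ)..t, (⟪f s, v.1⟫_ℝ - elasticForm C (u s) v)

/-! ### Meshes and discontinuous Galerkin spaces -/

/-- A subdivision of `Ω` into finitely many disjoint open convex polytopes, without hanging nodes:
the closures of two elements meet in a common face (possibly empty). -/
structure Mesh {d : ℕ} (Ω : Set (E d)) where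
  elements : Finset (Set (E d))
  polytope : ∀ K ∈ elements, ∃ s : Finset (E d), K = interior (convexHull ℝ (s : Set (E d)))
  nonempty : ∀ K ∈ elements, K.Nonempty
  subset : ∀ K ∈ elements, K ⊆ Ω
  disjoint : ∀ K ∈ elements, ∀ K' ∈ elements, K ≠ K' → Disjoint K K'
  cover : closure Ω = ⋃ K ∈ elements, closure K
  conforming : ∀ K ∈ elements, ∀ K' ∈ elements, K ≠ K' →
    IsExposed ℝ (closure K) (closure K ∩ closure K')

/-- Vectors of polynomials in `d` variables. -/
abbrev PolyVec (d : ℕ) := Fin d → MvPolynomial (Fin d) ℝ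

/-- The value of a vector of polynomials at a point. -/
def PolyVec.val {d : ℕ} (p : PolyVec d) (x : E d) : E d :=
  WithLp.toLp 2 fun i => MvPolynomial.eval (fun k => x k) (p i)

/-- The strain `ε(p)` at a point. -/
def PolyVec.strain {d : ℕ} (p : PolyVec d) (x : E d) : Fin d → Fin d → ℝ :=
  symPart fun i j => MvPolynomial.eval (fun k => x k) (MvPolynomial.pderiv j (p i))

/-- The traction `σ(p) ν` at a point, for the constant stiffness tensor `c`. -/
def PolyVec.traction {d : ℕ} (c : Ten4 d) (p : PolyVec d) (x ν : E d) : E d :=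
  WithLp.toLp 2 fun i => ∑ j, (∑ k, ∑ l, c i j k l * p.strain x k l) * ν j

/-- The space `V_h` of fields whose restriction to every element is a vector of polynomials of total
degree at most `r`. -/
def dgSpace {d : ℕ} {Ω : Set (E d)} (𝒯 : Mesh Ω) (r : ℕ) : Submodule ℝ (L2v Ω) where
  carrier := {v | ∀ K ∈ 𝒯.elements, ∃ p : PolyVec d, (∀ i, (p i).totalDegree ≤ r) ∧
    v =ᵐ[volume.restrict K] p.val}
  zero_mem' := by
    intro K hK
    refine ⟨0, fun i => by simp, ?_⟩
    have h := Lp.coeFn_zero (E d) 2 (volume.restrict Ω)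
    filter_upwards [ae_restrict_of_ae_restrict_of_subset (𝒯.subset K hK) h] with x hx
    rw [hx]
    ext i
    simp [PolyVec.val]
  add_mem' := by
    intro v w hv hw K hK
    obtain ⟨p, hp, hpv⟩ := hv K hK
    obtain ⟨q, hq, hqw⟩ := hw K hK
    refine ⟨p + q, fun i => (MvPolynomial.totalDegree_add _ _).trans (max_le (hp i) (hq i)), ?_⟩
    filter_upwards [hpv, hqw, ae_restrict_of_ae_restrict_of_subset (𝒯.subset K hK)
      (Lp.coeFn_add v w)] with x h1 h2 h3
    rw [h3, Pi.add_apply, h1, h2]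
    ext i
    simp [PolyVec.val]
  smul_mem' := by
    intro c v hv K hK
    obtain ⟨p, hp, hpv⟩ := hv K hK
    refine ⟨c • p, fun i => (MvPolynomial.totalDegree_smul_le _ _).trans (hp i), ?_⟩
    filter_upwards [hpv, ae_restrict_of_ae_restrict_of_subset (𝒯.subset K hK)
      (Lp.coeFn_smul c v)] with x h1 h3
    rw [h3, Pi.smul_apply, h1]
    ext i
    simp [PolyVec.val]

theorem PolyVec.continuous_val {d : ℕ} (p : PolyVec d) : Continuous p.val := by
  refine (PiLp.continuous_toLp 2 _).comp (continuous_pi fun i => ?_)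
  exact (MvPolynomial.continuous_eval (p i)).comp
    (continuous_pi fun k => (EuclideanSpace.proj (𝕜 := ℝ) k).continuous)

theorem Mesh.isOpen {d : ℕ} {Ω : Set (E d)} (𝒯 : Mesh Ω) {K : Set (E d)} (hK : K ∈ 𝒯.elements) :
    IsOpen K := by
  obtain ⟨s, rfl⟩ := 𝒯.polytope K hK
  exact isOpen_interior

theorem Mesh.isBounded {d : ℕ} {Ω : Set (E d)} (𝒯 : Mesh Ω) {K : Set (E d)}
    (hK : K ∈ 𝒯.elements) : Bornology.IsBounded K := by
  obtain ⟨s, rfl⟩ := 𝒯.polytope K hK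
  exact ((isBounded_convexHull (s := (s : Set (E d)))).2 s.finite_toSet.isBounded).subset
    interior_subset

theorem Mesh.ae_mem {d : ℕ} {Ω : Set (E d)} (𝒯 : Mesh Ω) :
    ∀ᵐ x ∂volume.restrict Ω, ∃ K ∈ 𝒯.elements, x ∈ K := by
  have hnull : ∀ K ∈ 𝒯.elements, volume (frontier K) = 0 := by
    intro K hK
    obtain ⟨s, rfl⟩ := 𝒯.polytope K hK
    exact Convex.addHaar_frontier _ (convex_convexHull ℝ _).interior
  have h0 : volume (⋃ K ∈ 𝒯.elements, frontier K) = 0 :=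
    (measure_biUnion_null_iff 𝒯.elements.countable_toSet).2 hnull
  have h1 : ∀ᵐ x ∂volume.restrict Ω, x ∉ ⋃ K ∈ 𝒯.elements, frontier K :=
    ae_restrict_of_ae (measure_eq_zero_iff_ae_notMem.1 h0)
  have hcl : closure Ω ⊆ ⋃ K ∈ 𝒯.elements, closure K := 𝒯.cover.le
  have h2 : ∀ᵐ x ∂volume.restrict Ω, x ∈ closure Ω := by
    have : ∀ᵐ x ∂volume.restrict (closure Ω), x ∈ closure Ω :=
      ae_restrict_mem isClosed_closure.measurableSet
    exact ae_restrict_of_ae_restrict_of_subset subset_closure this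
  filter_upwards [h1, h2] with x hx hx2
  obtain ⟨K, hK, hxK⟩ := mem_iUnion₂.1 (hcl hx2)
  refine ⟨K, hK, ?_⟩
  by_contra hn
  exact hx (mem_iUnion₂.2 ⟨K, hK, hxK, by rwa [(𝒯.isOpen hK).interior_eq]⟩)

theorem memLp_indicator_val {d : ℕ} {Ω : Set (E d)} (𝒯 : Mesh Ω) {K : Set (E d)}
    (hK : K ∈ 𝒯.elements) (p : PolyVec d) :
    MemLp (K.indicator p.val) 2 (volume.restrict Ω) := by
  have hm := (𝒯.isOpen hK).measurableSet
  rw [memLp_indicator_iff_restrict hm, Measure.restrict_restrict hm,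
    inter_eq_left.2 (𝒯.subset K hK)]
  have hc : IsCompact (closure K) := (𝒯.isBounded hK).isCompact_closure
  obtain ⟨M, hM⟩ := hc.exists_bound_of_continuousOn p.continuous_val.continuousOn
  have : IsFiniteMeasure (volume.restrict K) := ⟨by
    simpa using (𝒯.isBounded hK).measure_lt_top⟩
  refine MemLp.of_bound p.continuous_val.aestronglyMeasurable M ?_
  filter_upwards [ae_restrict_mem hm] with x hx
  exact hM x (subset_closure hx)

instance dgSpace.finiteDimensional {d : ℕ} {Ω : Set (E d)} (𝒯 : Mesh Ω) (r : ℕ) :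
    FiniteDimensional ℝ (dgSpace 𝒯 r) := by
  classical
  let P := {K // K ∈ 𝒯.elements} → Fin d → MvPolynomial.restrictTotalDegree (Fin d) ℝ r
  let R : P → L2v Ω := fun p => ∑ K : {K // K ∈ 𝒯.elements},
    (memLp_indicator_val 𝒯 K.2 fun i => (p K i : MvPolynomial (Fin d) ℝ)).toLp
  let L : P →ₗ[ℝ] L2v Ω :=
    { toFun := R
      map_add' := by
        intro p q
        simp only [R]
        rw [← Finset.sum_add_distrib]
        refine Finset.sum_congr rfl fun K _ => ?_
        rw [← MemLp.toLp_add]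
        congr 1
        ext x i
        by_cases hx : x ∈ K.1
        · simp only [hx, indicator_of_mem, PolyVec.val, Pi.add_apply, PiLp.add_apply]
          exact map_add (MvPolynomial.eval fun k => x k) (p K i : MvPolynomial (Fin d) ℝ) (q K i)
        · simp [hx]
      map_smul' := by
        intro c p
        simp only [R, RingHom.id_apply]
        rw [Finset.smul_sum]
        refine Finset.sum_congr rfl fun K _ => ?_
        rw [← MemLp.toLp_const_smul]
        congr 1
        ext x i
        by_cases hx : x ∈ K.1
        · simp only [hx, indicator_of_mem, PolyVec.val, Pi.smul_apply, PiLp.smul_apply]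
          exact MvPolynomial.smul_eval (fun k => x k) (p K i : MvPolynomial (Fin d) ℝ) c
        · simp [hx] }
  have hle : dgSpace 𝒯 r ≤ LinearMap.range L := by
    intro v hv
    choose p hp hpv using hv
    refine ⟨fun K i => ⟨p K.1 K.2 i,
      (MvPolynomial.mem_restrictTotalDegree _ _ _).2 (hp K.1 K.2 i)⟩, ?_⟩
    change R _ = v
    have hs : ∀ K : {K // K ∈ 𝒯.elements}, ∀ᵐ x ∂volume.restrict Ω,
        MemLp.toLp _ (memLp_indicator_val 𝒯 K.2 (p K.1 K.2)) x = K.1.indicator (p K.1 K.2).val x :=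
      fun K => MemLp.coeFn_toLp _
    have hv' : ∀ K : {K // K ∈ 𝒯.elements}, ∀ᵐ x ∂volume.restrict Ω,
        x ∈ K.1 → v x = (p K.1 K.2).val x := by
      intro K
      have hm := (𝒯.isOpen K.2).measurableSet
      have h := hpv K.1 K.2
      have hr : (volume : Measure (E d)).restrict K.1 = (volume.restrict Ω).restrict K.1 := by
        rw [Measure.restrict_restrict hm, inter_eq_left.2 (𝒯.subset K.1 K.2)]
      rw [hr] at h
      exact (ae_restrict_iff' hm).1 h
    apply Lp.ext
    simp only [R]
    filter_upwards [Lp.coeFn_finsetSum Finset.univ (fun K : {K // K ∈ 𝒯.elements} =>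
      (memLp_indicator_val 𝒯 K.2 (p K.1 K.2)).toLp _), ae_all_iff.2 hs, ae_all_iff.2 hv',
      𝒯.ae_mem] with x h1 h2 h3 h4
    obtain ⟨K, hK, hxK⟩ := h4
    rw [h1, Finset.sum_apply, Finset.sum_congr rfl fun K _ => h2 K,
      Finset.sum_eq_single (⟨K, hK⟩ : {K // K ∈ 𝒯.elements})]
    · rw [indicator_of_mem hxK, h3 ⟨K, hK⟩ hxK]
    · intro K' _ hne
      refine indicator_of_notMem (fun hx' => ?_) _
      exact Set.disjoint_left.1 (𝒯.disjoint K'.1 K'.2 K hK fun h => hne (Subtype.ext h)) hx' hxK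
    · simp
  exact Submodule.finiteDimensional_of_le hle

/-! ### The interior penalty form -/

/-- The vector of polynomials that agrees with `v` on the element `K`. -/
def piece {d : ℕ} {Ω : Set (E d)} (v : L2v Ω) (K : Set (E d)) : PolyVec d :=
  Classical.epsilon fun p : PolyVec d => v =ᵐ[volume.restrict K] p.val

/-- The outward unit normal of the convex set `K` at a boundary point `x`. For a polytope it is
uniquely determined at almost every boundary point. -/
def outwardNormal {d : ℕ} (K : Set (E d)) (x : E d) : E d :=
  Classical.epsilon fun ν : E d => ‖ν‖ = 1 ∧ ∀ y ∈ K, ⟪ν, y - x⟫_ℝ ≤ 0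

/-- The value on `K` of a tensor field that is constant on `K`. -/
def valueOn {d : ℕ} (C : E d → Ten4 d) (K : Set (E d)) : Ten4 d :=
  C (Classical.epsilon fun x => x ∈ K)

/-- The contribution of the interior face `∂K ∩ ∂K'` to `a_h(u, v)`, with `K⁺ = K`, `K⁻ = K'` and
`𝗁 = min(h_K, h_K')`. -/
def interiorFaceTerm {d : ℕ} {Ω : Set (E d)} (C : E d → Ten4 d) (α : ℝ) (K K' : Set (E d))
    (u v : L2v Ω) : ℝ :=
  ∫ x in frontier K ∩ frontier K' ∩ Ω,
    (- ⟪(1 / 2 : ℝ) • ((piece u K).traction (valueOn C K) x (outwardNormal K x)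
          + (piece u K').traction (valueOn C K') x (outwardNormal K x)),
        (piece v K).val x - (piece v K').val x⟫_ℝ
      - ⟪(1 / 2 : ℝ) • ((piece v K).traction (valueOn C K) x (outwardNormal K x)
          + (piece v K').traction (valueOn C K') x (outwardNormal K x)),
        (piece u K).val x - (piece u K').val x⟫_ℝ
      + α / min (Metric.diam K) (Metric.diam K')
        * ⟪(piece u K).val x - (piece u K').val x, (piece v K).val x - (piece v K').val x⟫_ℝ)
    ∂(μHE[d - 1] : Measure (E d))

/-- The contribution of the boundary faces of `K` to `a_h(u, v)`. -/
def boundaryFaceTerm {d : ℕ} {Ω : Set (E d)} (C : E d → Ten4 d) (α : ℝ) (K : Set (E d))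
    (u v : L2v Ω) : ℝ :=
  ∫ x in frontier K ∩ frontier Ω,
    (- ⟪(piece u K).traction (valueOn C K) x (outwardNormal K x), (piece v K).val x⟫_ℝ
      - ⟪(piece v K).traction (valueOn C K) x (outwardNormal K x), (piece u K).val x⟫_ℝ
      + α / Metric.diam K * ⟪(piece u K).val x, (piece v K).val x⟫_ℝ)
    ∂(μHE[d - 1] : Measure (E d))

open Classical in
/-- The symmetric interior penalty form `a_h` with penalty function `α 𝗁⁻¹`. The face terms do not
depend on which neighbour is called `K⁺`, so that the sum over the interior faces is half the sum
over the ordered pairs of distinct elements. -/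
def dgForm {d : ℕ} {Ω : Set (E d)} (𝒯 : Mesh Ω) (C : E d → Ten4 d) (α : ℝ) (u v : L2v Ω) : ℝ :=
  (∑ K ∈ 𝒯.elements, ∫ x in K,
      contract (valueOn C K) ((piece u K).strain x) ((piece v K).strain x))
  + (1 / 2) * ∑ K ∈ 𝒯.elements, ∑ K' ∈ 𝒯.elements.erase K, interiorFaceTerm C α K K' u v
  + ∑ K ∈ 𝒯.elements, boundaryFaceTerm C α K u v

/-- The Riesz representative in the finite dimensional subspace `V` of a functional that is linear
on `V`. -/
def rieszRep {H : Type*} [NormedAddCommGroup H] [InnerProductSpace ℝ H] (V : Submodule ℝ H)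
    [FiniteDimensional ℝ V] (ℓ : H → ℝ) : H :=
  ∑ i, ℓ (stdOrthonormalBasis ℝ V i : V) • ((stdOrthonormalBasis ℝ V i : V) : H)

theorem rieszRep_spec {H : Type*} [NormedAddCommGroup H] [InnerProductSpace ℝ H]
    (V : Submodule ℝ H) [FiniteDimensional ℝ V] (ℓ : H → ℝ) (L : V →ₗ[ℝ] ℝ)
    (hL : ∀ v : V, ℓ v = L v) :
    rieszRep V ℓ ∈ V ∧ ∀ v : V, ⟪rieszRep V ℓ, (v : H)⟫_ℝ = ℓ v := by
  refine ⟨Submodule.sum_mem _ fun i _ => V.smul_mem _ (SetLike.coe_mem _), fun v => ?_⟩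
  have hv := (stdOrthonormalBasis ℝ V).sum_repr' v
  rw [hL]
  conv_rhs => rw [← hv]
  simp only [rieszRep, sum_inner, real_inner_smul_left, hL, map_sum, map_smul, smul_eq_mul,
    Submodule.coe_inner]
  exact Finset.sum_congr rfl fun i _ => mul_comm _ _

/-- The discrete operator `B : V_h → V_h`, `(B z, v) = a_h(z, v)` for all `v ∈ V_h`. -/
def discreteOp {d : ℕ} {Ω : Set (E d)} (𝒯 : Mesh Ω) (r : ℕ) (C : E d → Ten4 d) (α : ℝ)
    (z : L2v Ω) : L2v Ω :=
  rieszRep (dgSpace 𝒯 r) (dgForm 𝒯 C α z)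

/-- The orthogonal projection `Π_h` of `L²(Ω)^d` onto `V_h`. -/
def proj {d : ℕ} {Ω : Set (E d)} (𝒯 : Mesh Ω) (r : ℕ) (v : L2v Ω) : L2v Ω :=
  (dgSpace 𝒯 r).starProjection v

/-! ### Time discretization -/

section Time

variable {X : Type*} [NormedAddCommGroup X] [NormedSpace ℝ X]

/-- Backward difference `∂xⁿ = (xⁿ - xⁿ⁻¹)/τ`, with a prescribed value `∂x⁰`. -/
def bdiff (τ : ℝ) (x : ℕ → X) (dx₀ : X) : ℕ → X
  | 0 => dx₀
  | n + 1 => τ⁻¹ • (x (n + 1) - x n)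

/-- Second backward difference `∂²xⁿ = (∂xⁿ - ∂xⁿ⁻¹)/τ`, used for `n ≥ 1`. -/
def bdiff2 (τ : ℝ) (x : ℕ → X) (dx₀ : X) (n : ℕ) : X :=
  τ⁻¹ • (bdiff τ x dx₀ n - bdiff τ x dx₀ (n - 1))

/-- The `n ≥ 1` with `t ∈ (tⁿ⁻¹, tⁿ]`, `tⁿ = n τ`; the time `0` is put into the first interval. -/
def stepIdx (τ t : ℝ) : ℕ := max 1 ⌈t / τ⌉₊

/-- The `C¹` piecewise cubic time reconstruction of `x⁰, x¹, …` and `∂x⁰`. -/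
def cubicRecon (τ : ℝ) (x : ℕ → X) (dx₀ : X) (t : ℝ) : X :=
  let n := stepIdx τ t
  ((t - (n - 1) * τ) / τ) • x n + ((n * τ - t) / τ) • x (n - 1)
    - ((t - (n - 1) * τ) * (n * τ - t) ^ 2 / τ) • bdiff2 τ x dx₀ n

/-- `f̃⁰ = f(0)` and `f̃ⁿ = τ⁻¹ ∫_{tⁿ⁻¹}^{tⁿ} f`. -/
def timeAverage (τ : ℝ) (f : ℝ → X) : ℕ → X
  | 0 => f 0
  | n + 1 => τ⁻¹ • ∫ t in (n * τ)..((n + 1) * τ), f t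

/-- `μⁿ(t) = -6 τ⁻¹ (t - (tⁿ + tⁿ⁻¹)/2)`. -/
def timeWeight (τ : ℝ) (n : ℕ) (t : ℝ) : ℝ := -6 / τ * (t - (n * τ + (n - 1) * τ) / 2)

/-- The constants `γ_n`. -/
def evoConst (τ : ℝ) (g : ℕ → X) (dg₀ : X) : ℕ → X
  | 0 => 0
  | n + 1 => evoConst τ g dg₀ n + (τ ^ 2 / 2) • bdiff τ g dg₀ (n + 1)
      + (τ ^ 3 / 12) • bdiff2 τ g dg₀ (n + 1)

/-- The function `𝒢`. -/
def evoFun (τ : ℝ) (g : ℕ → X) (dg₀ : X) (t : ℝ) : X :=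
  let n := stepIdx τ t
  ((n * τ - t) ^ 2 / 2) • bdiff τ g dg₀ n
    - ((n * τ - t) ^ 4 / (4 * τ) - (n * τ - t) ^ 3 / 3) • bdiff2 τ g dg₀ n - evoConst τ g dg₀ n

/-- The evolution indicator `ζ_evo`. -/
def zetaEvo (τ : ℝ) (N : ℕ) (g : ℕ → X) (dg₀ : X) : ℝ :=
  ∫ t in (0 : ℝ)..(N * τ), ‖evoFun τ g dg₀ t‖

/-- The data indicator `ζ_osc`. -/
def zetaOsc (τ : ℝ) (N : ℕ) (f : ℝ → X) : ℝ :=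
  1 / (2 * Real.pi) * ∑ n ∈ Finset.Icc 1 N,
    Real.sqrt (∫ t in (((n : ℝ) - 1) * τ)..(n * τ), τ ^ 3 * ‖timeAverage τ f n - f t‖ ^ 2)

/-- The time reconstruction indicator `ζ_T.Rec`. -/
def zetaTRec (τ : ℝ) (N : ℕ) (x : ℕ → X) (dx₀ : X) : ℝ :=
  1 / (2 * Real.pi) * ∑ n ∈ Finset.Icc 1 N,
    Real.sqrt (∫ t in (((n : ℝ) - 1) * τ)..(n * τ),
      τ ^ 3 * ‖timeWeight τ n t • bdiff2 τ x dx₀ n‖ ^ 2)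

end Time

/-- The mesh change indicator `ζ_MC`. -/
def zetaMC {d : ℕ} {Ω : Set (E d)} (𝒯 : ℕ → Mesh Ω) (r : ℕ) (τ : ℝ) (N : ℕ) (uh : ℕ → L2v Ω)
    (duh₀ : L2v Ω) : ℝ :=
  (∑ n ∈ Finset.Icc 1 N, ∫ t in (((n : ℝ) - 1) * τ)..(n * τ),
    ‖deriv (cubicRecon τ uh duh₀) t - proj (𝒯 n) r (deriv (cubicRecon τ uh duh₀) t)‖)
  + ∑ n ∈ Finset.range N, (N * τ - n * τ) *
      ‖proj (𝒯 (n + 1)) r (bdiff τ uh duh₀ n) - proj (𝒯 n) r (bdiff τ uh duh₀ n)‖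

/-- The fully discrete solution: `u_hⁿ ∈ V_hⁿ` for `n ≤ N`, `u_h⁰ = Π_h⁰ u₀`, `∂u_h⁰ = Π_h⁰ u₁`, and
`(∂²u_hⁿ, v) + a_hⁿ(u_hⁿ, v) = (f(tⁿ), v)` for all `v ∈ V_hⁿ`, `1 ≤ n ≤ N`. -/
structure IsDiscreteSolution {d : ℕ} {Ω : Set (E d)} (𝒯 : ℕ → Mesh Ω) (r : ℕ) (C : E d → Ten4 d)
    (α τ : ℝ) (N : ℕ) (f : ℝ → L2v Ω) (u₀ u₁ : L2v Ω) (uh : ℕ → L2v Ω) (duh₀ : L2v Ω) : Prop where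
  mem : ∀ n ≤ N, uh n ∈ dgSpace (𝒯 n) r
  init : uh 0 = proj (𝒯 0) r u₀
  init_deriv : duh₀ = proj (𝒯 0) r u₁
  step : ∀ n, 1 ≤ n → n ≤ N → ∀ v ∈ dgSpace (𝒯 n) r,
    ⟪bdiff2 τ uh duh₀ n, v⟫_ℝ + dgForm (𝒯 n) C α (uh n) v = ⟪f (n * τ), v⟫_ℝ

/-- The right-hand sides `gⁿ = Bⁿ u_hⁿ - Π_hⁿ f(tⁿ) + f̃ⁿ` of the reconstruction problems. -/
def reconData {d : ℕ} {Ω : Set (E d)} (𝒯 : ℕ → Mesh Ω) (r : ℕ) (C : E d → Ten4 d) (α τ : ℝ)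
    (f : ℝ → L2v Ω) (uh : ℕ → L2v Ω) (n : ℕ) : L2v Ω :=
  discreteOp (𝒯 n) r C α (uh n) - proj (𝒯 n) r (f (n * τ)) + timeAverage τ f n

/-- The right-hand side `∂g⁰ = B⁰ ∂u_h⁰ - Π_h⁰ f(0) + f(0)`. -/
def reconData₀ {d : ℕ} {Ω : Set (E d)} (𝒯 : ℕ → Mesh Ω) (r : ℕ) (C : E d → Ten4 d) (α : ℝ)
    (f : ℝ → L2v Ω) (duh₀ : L2v Ω) : L2v Ω :=
  discreteOp (𝒯 0) r C α duh₀ - proj (𝒯 0) r (f 0) + f 0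

end ElastoDG

end

/-! Split `e_N = ρ - θ_N` with `ρ = w_N - u`. Unlike `e_N`, the function `ρ` has values in `H¹₀` and
may be used as a test function. Integrating the wave equation and the stationary problems `a(w_N, φ)
= (g_N, φ)` once in time gives `(∂ₜ(u_N - u), φ) + a(∫₀ᵗ ρ, φ) = (∂u_h⁰ - u₁ + Q(t), φ)`, `Q(t) =
∂ₜu_N(t) - ∂u_h⁰ + ∫₀ᵗ (g_N - f)`. Now take `φ = ρ(t)`, which is Baker's argument for `L^∞(L²)`
bounds. Since `∂ₜρ = ∂ₜ(u_N - u) + ∂ₜθ_N`, the left side is half the derivative of `‖ρ‖² + a(∫ρ,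
∫ρ)`, minus `(∂ₜθ_N, ρ)`. The initial velocity error is absorbed into `a(∫ρ, ∫ρ)` by the Poincaré
inequality and Korn's inequality, and Ou-Iang's inequality removes the square. The result is `‖ρ(t)‖
≤ ‖ρ(0)‖ + κ + ∫₀ᵗ ‖Q + ∂ₜθ_N‖` (`energy_bound`, `norm_recon_sub_le_residual`).

Korn's inequality on `H¹₀` has the form `a(v, v) ≥ (c⋆/2) ‖∇v‖²`. It holds because `U : Uᵀ - (tr
U)²` is a null Lagrangian: evaluated at a gradient of an `H¹₀` field, it integrates to zero
(`nullCLM_H10`, `elasticCLM_coercive`).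

It remains to bound `∫ ‖Q‖`. For `n ≥ 1` the scheme turns the data into `gⁿ = f̃ⁿ - Πⁿ ∂²u_hⁿ`
(`reconData_succ`), so neither coercivity nor consistency of `a_h` is needed. On the `n`th interval
`∂ₜₜu_N = (1 + μⁿ) ∂²u_hⁿ`, hence `∂ₜₜu_N + g_N - f = (I - Πⁿ) ∂ₜₜu_N + (g_N - gⁿ) + (f̃ⁿ - f) + μⁿ
Πⁿ ∂²u_hⁿ`. In the time integral the first term leaves `(I - Πⁿ) ∂ₜu_N` and the changes of the
projection at the nodes, and the second has the continuous primitive `𝒢`. The last two have mean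
zero on every interval, so that their primitives vanish at the nodes and do not accumulate
(`integratedResidual_eq`, `integral_norm_primitive_le`).

Several constants come out smaller than stated and are relaxed at the end. -/

open Filter Topology

namespace ElastoDG

/-! ### Absolutely continuous functions and the energy identity -/

/-- A function whose increments are controlled by those of an absolutely continuous function is
absolutely continuous. -/
theorem absolutelyContinuousOnInterval_of_dist_le {X Y : Type*} [PseudoMetricSpace X]
    [PseudoMetricSpace Y] {f : ℝ → X} {h : ℝ → Y} {a b K : ℝ}
    (hh : AbsolutelyContinuousOnInterval h a b)
    (hfh : ∀ x ∈ uIcc a b, ∀ y ∈ uIcc a b, dist (f x) (f y) ≤ K * dist (h x) (h y)) :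
    AbsolutelyContinuousOnInterval f a b := by
  unfold AbsolutelyContinuousOnInterval at *
  have hK := hh.const_mul K
  rw [mul_zero] at hK
  refine squeeze_zero' (Eventually.of_forall fun _ => Finset.sum_nonneg fun _ _ => dist_nonneg)
    ?_ hK
  have hmem : ∀ᶠ E in AbsolutelyContinuousOnInterval.totalLengthFilter ⊓
      𝓟 (AbsolutelyContinuousOnInterval.disjWithin a b),
      E ∈ AbsolutelyContinuousOnInterval.disjWithin a b :=
    mem_inf_of_right (mem_principal_self _)
  filter_upwards [hmem] with E hE
  rw [Finset.mul_sum]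
  exact Finset.sum_le_sum fun i hi => hfh _ (hE.1 i hi).1 _ (hE.1 i hi).2

/-- The energy identity `B(F, F)(t) = B(c, c) + 2 ∫₀ᵗ B(F, G)` for `F(t) = c + ∫₀ᵗ G`. -/
theorem energy_identity {X : Type*} [NormedAddCommGroup X] [NormedSpace ℝ X] [CompleteSpace X]
    (B : X →L[ℝ] X →L[ℝ] ℝ) (hB : ∀ x y, B x y = B y x) {T : ℝ} {F G : ℝ → X} {c : X}
    (hT : 0 ≤ T) (hG : IntervalIntegrable G volume 0 T)
    (hF : ∀ t ∈ Icc 0 T, F t = c + ∫ s in (0 : ℝ)..t, G s) :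
    B (F T) (F T) = B c c + 2 * ∫ s in (0 : ℝ)..T, B (F s) (G s) := by
  have hsub : ∀ x ∈ Icc 0 T, IntervalIntegrable G volume 0 x := fun x hx =>
    hG.mono_set (by rw [uIcc_of_le hx.1, uIcc_of_le hT]; exact Icc_subset_Icc_right hx.2)
  have hdiff : ∀ x ∈ Icc 0 T, ∀ y ∈ Icc 0 T, ‖F x - F y‖ ≤
      dist (∫ s in (0 : ℝ)..x, ‖G s‖) (∫ s in (0 : ℝ)..y, ‖G s‖) := by
    intro x hx y hy
    rw [hF x hx, hF y hy, add_sub_add_left_eq_sub,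
      intervalIntegral.integral_interval_sub_left (hsub x hx) (hsub y hy), Real.dist_eq,
      intervalIntegral.integral_interval_sub_left (hsub x hx).norm (hsub y hy).norm]
    exact intervalIntegral.norm_integral_le_abs_integral_norm
  have hcont : ContinuousOn F (Icc 0 T) := by
    have h1 : ContinuousOn (fun t => c + ∫ s in (0 : ℝ)..t, G s) (Icc 0 T) :=
      continuousOn_const.add (by
        have := intervalIntegral.continuousOn_primitive_interval' hG left_mem_uIcc
        rwa [uIcc_of_le hT] at this)
    exact h1.congr hF
  obtain ⟨M, hM⟩ := isCompact_Icc.exists_bound_of_continuousOn hcont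
  -- Since `G` is merely integrable, `F` is differentiable only almost everywhere, and the
  -- fundamental theorem of calculus requires absolute continuity of `B(F, F)`. It is inherited from
  -- `∫ ‖G‖`, because `F` is bounded by `M`.
  have hAC : AbsolutelyContinuousOnInterval (fun t => B (F t) (F t)) 0 T := by
    refine absolutelyContinuousOnInterval_of_dist_le (K := 2 * ‖B‖ * M)
      (hG.norm.absolutelyContinuousOnInterval_intervalIntegral left_mem_uIcc) fun x hx y hy => ?_
    rw [uIcc_of_le hT] at hx hy
    have h1 : B (F x) (F x) - B (F y) (F y) = B (F x) (F x - F y) + B (F y) (F x - F y) := by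
      rw [map_sub, map_sub, hB (F y) (F x)]; ring
    have hM0 : 0 ≤ M := (norm_nonneg _).trans (hM x hx)
    rw [Real.dist_eq, h1]
    calc |B (F x) (F x - F y) + B (F y) (F x - F y)|
        ≤ ‖B (F x) (F x - F y)‖ + ‖B (F y) (F x - F y)‖ := abs_add_le _ _
      _ ≤ ‖B‖ * ‖F x‖ * ‖F x - F y‖ + ‖B‖ * ‖F y‖ * ‖F x - F y‖ :=
          add_le_add (B.le_opNorm₂ _ _) (B.le_opNorm₂ _ _)
      _ ≤ ‖B‖ * M * ‖F x - F y‖ + ‖B‖ * M * ‖F x - F y‖ := by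
          gcongr
          · exact hM x hx
          · exact hM y hy
      _ = 2 * ‖B‖ * M * ‖F x - F y‖ := by ring
      _ ≤ _ := by
          gcongr
          exact hdiff x hx y hy
  have hF0 : F 0 = c := by rw [hF 0 (left_mem_Icc.2 hT)]; simp
  have hFTC := hAC.integral_deriv_eq_sub
  rw [hF0] at hFTC
  have hder : ∫ s in (0 : ℝ)..T, deriv (fun t => B (F t) (F t)) s
      = ∫ s in (0 : ℝ)..T, 2 * B (F s) (G s) := by
    refine intervalIntegral.integral_congr_ae ?_
    have hne : ∀ᵐ x : ℝ, x ≠ T := by simp [ae_iff, measure_singleton]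
    filter_upwards [hG.ae_hasDerivAt_integral, hne] with x hx hxT hxm
    rw [uIoc_of_le hT] at hxm
    have hxI : x ∈ Ioo 0 T := ⟨hxm.1, lt_of_le_of_ne hxm.2 hxT⟩
    have h1 := (hx (by rw [uIcc_of_le hT]; exact Ioc_subset_Icc_self hxm) 0
      left_mem_uIcc).const_add c
    have h2 : HasDerivAt F (G x) x := by
      refine h1.congr_of_eventuallyEq ?_
      filter_upwards [Icc_mem_nhds hxI.1 hxI.2] with y hy using hF y hy
    have h3 : HasDerivAt (fun t => B (F t) (F t)) (B (G x) (F x) + B (F x) (G x)) x := by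
      have := (B.hasFDerivAt.comp_hasDerivAt x h2).clm_apply h2
      simpa using this
    rw [h3.deriv, hB (G x)]; ring
  rw [hder, intervalIntegral.integral_const_mul] at hFTC
  linarith

/-- Ou-Iang's inequality. -/
theorem le_add_integral_of_sq_le {T y₀ : ℝ} {y k : ℝ → ℝ} (hy₀ : 0 ≤ y₀)
    (hyc : ContinuousOn y (Icc 0 T)) (hkc : ContinuousOn k (Icc 0 T))
    (hy : ∀ t ∈ Icc 0 T, 0 ≤ y t) (hk : ∀ t ∈ Icc 0 T, 0 ≤ k t)
    (h : ∀ t ∈ Icc 0 T, y t ^ 2 ≤ y₀ ^ 2 + 2 * ∫ s in (0 : ℝ)..t, k s * y s) :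
    ∀ t ∈ Icc 0 T, y t ≤ y₀ + ∫ s in (0 : ℝ)..t, k s := by
  intro t ht
  have hT : 0 ≤ T := ht.1.trans ht.2
  -- The shift by `δ` keeps `Z` positive, so that `√Z` is differentiable even when `y₀ = 0`.
  refine le_of_forall_pos_le_add fun δ hδ => ?_
  set Z : ℝ → ℝ := fun t => (y₀ + δ) ^ 2 + 2 * ∫ s in (0 : ℝ)..t, k s * y s with hZ
  have hky : ContinuousOn (fun s => k s * y s) (Icc 0 T) := hkc.mul hyc
  have hint : ∀ x ∈ Icc 0 T, 0 ≤ ∫ s in (0 : ℝ)..x, k s * y s := fun x hx =>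
    intervalIntegral.integral_nonneg hx.1 fun s hs =>
      mul_nonneg (hk s ⟨hs.1, hs.2.trans hx.2⟩) (hy s ⟨hs.1, hs.2.trans hx.2⟩)
  have hZpos : ∀ x ∈ Icc 0 T, 0 < Z x := fun x hx => by
    have := hint x hx
    have : 0 < (y₀ + δ) ^ 2 := by positivity
    simp only [hZ]; linarith
  have hyZ : ∀ x ∈ Icc 0 T, y x ≤ √(Z x) := fun x hx => by
    refine Real.le_sqrt_of_sq_le ((h x hx).trans ?_)
    simp only [hZ]; nlinarith
  have prim_cont : ∀ {q : ℝ → ℝ}, ContinuousOn q (Icc 0 T) →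
      ContinuousOn (fun x => ∫ s in (0 : ℝ)..x, q s) (Icc 0 T) := fun {q} hq => by
    have := intervalIntegral.continuousOn_primitive_interval' (μ := volume)
      (ContinuousOn.intervalIntegrable (by rwa [uIcc_of_le hT])) (left_mem_uIcc (a := 0) (b := T))
      (f := q)
    rwa [uIcc_of_le hT] at this
  have prim_der : ∀ {q : ℝ → ℝ}, ContinuousOn q (Icc 0 T) → ∀ x ∈ Ioo 0 T,
      HasDerivAt (fun x => ∫ s in (0 : ℝ)..x, q s) (q x) x := fun {q} hq x hx => by
    refine intervalIntegral.integral_hasDerivAt_right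
      (ContinuousOn.intervalIntegrable (hq.mono ?_)) ?_ (hq.continuousAt (Icc_mem_nhds hx.1 hx.2))
    · rw [uIcc_of_le hx.1.le]; exact Icc_subset_Icc_right hx.2.le
    · exact ⟨Icc 0 T, Icc_mem_nhds hx.1 hx.2, hq.aestronglyMeasurable measurableSet_Icc⟩
  -- `(√Z)' = k y / √Z ≤ k`, because `y ≤ √Z`.
  have hanti : AntitoneOn (fun x => √(Z x) - ∫ s in (0 : ℝ)..x, k s) (Icc 0 T) := by
    refine antitoneOn_of_deriv_nonpos (convex_Icc 0 T) ?_ ?_ ?_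
    · exact (Real.continuous_sqrt.comp_continuousOn
        (continuousOn_const.add (continuousOn_const.mul (prim_cont hky)))).sub (prim_cont hkc)
    · intro x hx
      rw [interior_Icc] at hx
      have hx' := Ioo_subset_Icc_self hx
      exact ((((prim_der hky x hx).const_mul 2).const_add _ |>.sqrt (hZpos x hx').ne').sub
        (prim_der hkc x hx)).differentiableAt.differentiableWithinAt
    · intro x hx
      rw [interior_Icc] at hx
      have hx' := Ioo_subset_Icc_self hx
      have hd := (((prim_der hky x hx).const_mul 2).const_add ((y₀ + δ) ^ 2)
        |>.sqrt (hZpos x hx').ne').sub (prim_der hkc x hx)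
      have hd' : deriv (fun x => √(Z x) - ∫ s in (0 : ℝ)..x, k s) x = _ := hd.deriv
      rw [hd']
      have hs : 0 < √(Z x) := Real.sqrt_pos.2 (hZpos x hx')
      change 2 * (k x * y x) / (2 * √(Z x)) - k x ≤ 0
      rw [sub_nonpos, div_le_iff₀ (by positivity)]
      nlinarith [mul_le_mul_of_nonneg_left (hyZ x hx') (hk x hx')]
  have h0 := hanti (left_mem_Icc.2 hT) ht ht.1
  have hZ0 : √(Z 0) = y₀ + δ := by
    simp only [hZ, intervalIntegral.integral_same, mul_zero, add_zero]
    exact Real.sqrt_sq (by positivity)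
  simp only [hZ0, intervalIntegral.integral_same, sub_zero] at h0
  linarith [hyZ t ht]

/-- Otherwise a continuous functional separates the integral from `V`. Being bounded above on a
subspace, it vanishes on `V`, hence also at the integral. In the energy argument this makes `∫ρ`
admissible in the estimate of the initial velocity error. -/
theorem intervalIntegral_mem_of_ae_mem {X : Type*} [NormedAddCommGroup X] [NormedSpace ℝ X]
    [CompleteSpace X] (V : Submodule ℝ X) (hV : IsClosed (V : Set X)) {ρ : ℝ → X} {a b : ℝ}
    (hab : a ≤ b) (hρ : IntervalIntegrable ρ volume a b)
    (hm : ∀ᵐ t ∂volume.restrict (Ioo a b), ρ t ∈ V) : ∫ t in a..b, ρ t ∈ V := by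
  by_contra hn
  obtain ⟨ℓ, hℓ, hℓV⟩ : ∃ ℓ : X →L[ℝ] ℝ, ℓ (∫ t in a..b, ρ t) ≠ 0 ∧ ∀ v ∈ V, ℓ v = 0 := by
    obtain ⟨ℓ, s, h1, h2⟩ := geometric_hahn_banach_closed_point V.convex hV hn
    have h0 : ∀ v ∈ V, ℓ v = 0 := by
      intro v hv
      by_contra hne
      have h3 := h1 ((s / ℓ v) • v) (V.smul_mem _ hv)
      rw [map_smul, smul_eq_mul, div_mul_cancel₀ _ hne] at h3
      exact lt_irrefl _ h3
    refine ⟨ℓ, ?_, h0⟩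
    have h4 := h1 0 V.zero_mem
    rw [map_zero] at h4
    exact (h4.trans h2).ne'
  apply hℓ
  rw [← ContinuousLinearMap.intervalIntegral_comp_comm ℓ hρ, intervalIntegral.integral_of_le hab,
    integral_Ioc_eq_integral_Ioo]
  refine integral_eq_zero_of_ae ?_
  filter_upwards [hm] with t ht using hℓV _ ht

section Prod

variable {X Y : Type*} [NormedAddCommGroup X] [NormedSpace ℝ X] [NormedAddCommGroup Y]
  [NormedSpace ℝ Y] {q : ℝ → X × Y} {a b : ℝ}

theorem intervalIntegrable_snd (hq : IntervalIntegrable q volume a b) :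
    IntervalIntegrable (fun s => (q s).2) volume a b :=
  ⟨(ContinuousLinearMap.snd ℝ X Y).integrable_comp hq.1,
    (ContinuousLinearMap.snd ℝ X Y).integrable_comp hq.2⟩

variable [CompleteSpace X] [CompleteSpace Y]

theorem fst_intervalIntegral (hq : IntervalIntegrable q volume a b) :
    (∫ s in a..b, q s).1 = ∫ s in a..b, (q s).1 :=
  ((ContinuousLinearMap.fst ℝ X Y).intervalIntegral_comp_comm hq).symm

theorem snd_intervalIntegral (hq : IntervalIntegrable q volume a b) :
    (∫ s in a..b, q s).2 = ∫ s in a..b, (q s).2 :=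
  ((ContinuousLinearMap.snd ℝ X Y).intervalIntegral_comp_comm hq).symm

end Prod

/-- An `L^∞(L²)` bound for second order evolution problems in the once integrated form
`(σ, φ) + a(∫₀ᵗ ρ, φ) = (e₁ + Q, φ)`. -/
theorem energy_bound {H K : Type*} [NormedAddCommGroup H] [InnerProductSpace ℝ H] [CompleteSpace H]
    [NormedAddCommGroup K] [NormedSpace ℝ K] [CompleteSpace K] [SecondCountableTopology (H × K)]
    (V : Submodule ℝ (H × K)) (hV : IsClosed (V : Set (H × K)))
    (a : K →L[ℝ] K →L[ℝ] ℝ) (ha : ∀ x y, a x y = a y x)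
    {T κ : ℝ} (hT : 0 ≤ T) (hκ0 : 0 ≤ κ) {ρ : ℝ → H × K} {σ η Q : ℝ → H} {r₀ e₁ : H}
    (hρ : IntervalIntegrable ρ volume 0 T) (hρV : ∀ᵐ t ∂volume.restrict (Ioo 0 T), ρ t ∈ V)
    (hσ : IntervalIntegrable σ volume 0 T) (hη : Continuous η) (hQ : ContinuousOn Q (Icc 0 T))
    (hρ1 : ∀ t ∈ Icc 0 T, (ρ t).1 = r₀ + ∫ s in (0 : ℝ)..t, (σ s + η s))
    (hweak : ∀ φ ∈ V, ∀ᵐ t ∂volume.restrict (Ioo 0 T),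
      ⟪σ t, φ.1⟫_ℝ + a (∫ s in (0 : ℝ)..t, (ρ s).2) φ.2 = ⟪e₁ + Q t, φ.1⟫_ℝ)
    (hκ : ∀ v ∈ V, 2 * ⟪e₁, v.1⟫_ℝ ≤ a v.2 v.2 + κ ^ 2) :
    ∀ t ∈ Icc 0 T, ‖(ρ t).1‖ ≤ ‖r₀‖ + κ + ∫ s in (0 : ℝ)..t, ‖Q s + η s‖ := by
  -- The null set in `hweak` depends on `φ`, while the test function `ρ t` varies with `t`. A
  -- countable dense subset of `V` and continuity in `φ` provide one null set for all test
  -- functions.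
  have hall : ∀ᵐ t ∂volume.restrict (Ioo 0 T), ∀ φ ∈ V,
      ⟪σ t, φ.1⟫_ℝ + a (∫ s in (0 : ℝ)..t, (ρ s).2) φ.2 = ⟪e₁ + Q t, φ.1⟫_ℝ := by
    obtain ⟨D, hDc, hDd⟩ := TopologicalSpace.exists_countable_dense V
    have h1 : ∀ᵐ t ∂volume.restrict (Ioo 0 T), ∀ φ ∈ D,
        ⟪σ t, (φ : H × K).1⟫_ℝ + a (∫ s in (0 : ℝ)..t, (ρ s).2) (φ : H × K).2
          = ⟪e₁ + Q t, (φ : H × K).1⟫_ℝ :=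
      (ae_ball_iff hDc).2 fun φ _ => hweak φ φ.2
    filter_upwards [h1] with t ht φ hφ
    have hcl : IsClosed {ψ : V | ⟪σ t, (ψ : H × K).1⟫_ℝ
        + a (∫ s in (0 : ℝ)..t, (ρ s).2) (ψ : H × K).2 = ⟪e₁ + Q t, (ψ : H × K).1⟫_ℝ} :=
      isClosed_eq (by fun_prop) (by fun_prop)
    have : (⟨φ, hφ⟩ : V) ∈ closure D := hDd _
    exact hcl.closure_subset_iff.2 ht this
  have hρ2 : IntervalIntegrable (fun s => (ρ s).2) volume 0 T :=
    intervalIntegrable_snd hρ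
  have hρ1c : ContinuousOn (fun t => (ρ t).1) (Icc 0 T) := by
    have h1 : ContinuousOn (fun t => r₀ + ∫ s in (0 : ℝ)..t, (σ s + η s)) (Icc 0 T) :=
      continuousOn_const.add (by
        have := intervalIntegral.continuousOn_primitive_interval'
          (hσ.add (hη.intervalIntegrable 0 T)) left_mem_uIcc
        rwa [uIcc_of_le hT] at this)
    exact h1.congr hρ1
  have hmono : ∀ t ∈ Icc 0 T, uIcc 0 t ⊆ uIcc 0 T := fun t ht => by
    rw [uIcc_of_le ht.1, uIcc_of_le hT]; exact Icc_subset_Icc_right ht.2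
  set k : ℝ → ℝ := fun s => ‖Q s + η s‖
  have hkc : ContinuousOn k (Icc 0 T) := (hQ.add hη.continuousOn).norm
  -- The energy form on pairs. With `F = (ρ₁, ∫ρ₂)` and `G = (σ + η, ρ₂)` a single energy identity
  -- covers the kinetic and the elastic part.
  let B : (H × K) →L[ℝ] (H × K) →L[ℝ] ℝ :=
    (isBoundedBilinearMap_inner (𝕜 := ℝ) (E := H)).toContinuousLinearMap.bilinearComp
      (.fst ℝ H K) (.fst ℝ H K) + a.bilinearComp (.snd ℝ H K) (.snd ℝ H K)
  have hBa : ∀ x y : H × K, B x y = ⟪x.1, y.1⟫_ℝ + a x.2 y.2 := fun x y => rfl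
  have hB : ∀ x y, B x y = B y x := fun x y => by rw [hBa, hBa, real_inner_comm, ha]
  have key : ∀ t ∈ Icc 0 T, ‖(ρ t).1‖ ^ 2 ≤ √(‖r₀‖ ^ 2 + κ ^ 2) ^ 2
      + 2 * ∫ s in (0 : ℝ)..t, k s * ‖(ρ s).1‖ := by
    intro t ht
    have hρt := hρ.mono_set (hmono t ht)
    have hρ2t := hρ2.mono_set (hmono t ht)
    have hσt : IntervalIntegrable (fun s => σ s + η s) volume 0 t :=
      (hσ.mono_set (hmono t ht)).add (hη.intervalIntegrable 0 t)
    have hsub : Icc 0 t ⊆ Icc 0 T := Icc_subset_Icc_right ht.2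
    have hG : IntervalIntegrable (fun s => (σ s + η s, (ρ s).2)) volume 0 t :=
      ⟨hσt.1.prodMk hρ2t.1, hσt.2.prodMk hρ2t.2⟩
    have hE := energy_identity B hB (T := t) (G := fun s => (σ s + η s, (ρ s).2))
      (F := fun s => ((ρ s).1, ∫ x in (0 : ℝ)..s, (ρ x).2)) (c := (r₀, 0)) ht.1 hG (by
        intro s hs
        have hGs := hG.mono_set (c := 0) (d := s) (by
          rw [uIcc_of_le ht.1, uIcc_of_le hs.1]; exact Icc_subset_Icc_right hs.2)
        refine Prod.ext ?_ ?_
        · rw [Prod.fst_add, fst_intervalIntegral hGs]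
          exact hρ1 s (hsub hs)
        · rw [Prod.snd_add, snd_intervalIntegral hGs, zero_add])
    simp only [hBa, map_zero, add_zero, real_inner_self_eq_norm_sq] at hE
    have hP : ∫ s in (0 : ℝ)..t, ρ s ∈ V :=
      intervalIntegral_mem_of_ae_mem V hV ht.1 hρt
        (ae_restrict_of_ae_restrict_of_subset (Ioo_subset_Ioo_right ht.2) hρV)
    have hP1 : (∫ s in (0 : ℝ)..t, ρ s).1 = ∫ s in (0 : ℝ)..t, (ρ s).1 :=
      fst_intervalIntegral hρt
    have hP2 : (∫ s in (0 : ℝ)..t, ρ s).2 = ∫ s in (0 : ℝ)..t, (ρ s).2 :=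
      snd_intervalIntegral hρt
    have hκP := hκ _ hP
    have hρ1t : IntervalIntegrable (fun s => (ρ s).1) volume 0 t :=
      ContinuousOn.intervalIntegrable (by rw [uIcc_of_le ht.1]; exact hρ1c.mono hsub)
    have he1 : ⟪e₁, (∫ s in (0 : ℝ)..t, ρ s).1⟫_ℝ = ∫ s in (0 : ℝ)..t, ⟪e₁, (ρ s).1⟫_ℝ := by
      rw [hP1]
      exact ((innerSL ℝ e₁).intervalIntegral_comp_comm hρ1t).symm
    have hc1 : IntervalIntegrable (fun s => ⟪e₁, (ρ s).1⟫_ℝ) volume 0 t :=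
      ContinuousOn.intervalIntegrable (by
        rw [uIcc_of_le ht.1]; exact continuousOn_const.inner (hρ1c.mono hsub))
    have hc2 : IntervalIntegrable (fun s => ⟪Q s + η s, (ρ s).1⟫_ℝ) volume 0 t :=
      ContinuousOn.intervalIntegrable (by
        rw [uIcc_of_le ht.1]
        exact ((hQ.add hη.continuousOn).inner hρ1c).mono hsub)
    have hc3 : IntervalIntegrable (fun s => k s * ‖(ρ s).1‖) volume 0 t :=
      ContinuousOn.intervalIntegrable (by
        rw [uIcc_of_le ht.1]; exact (hkc.mul hρ1c.norm).mono hsub)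
    -- The equation is tested with `φ = ρ s` here.
    have hint : ∫ s in (0 : ℝ)..t, (⟪(ρ s).1, σ s + η s⟫_ℝ
          + a (∫ x in (0 : ℝ)..s, (ρ x).2) (ρ s).2)
        = ∫ s in (0 : ℝ)..t, (⟪e₁, (ρ s).1⟫_ℝ + ⟪Q s + η s, (ρ s).1⟫_ℝ) := by
      rw [intervalIntegral.integral_of_le ht.1, intervalIntegral.integral_of_le ht.1,
        integral_Ioc_eq_integral_Ioo, integral_Ioc_eq_integral_Ioo]
      refine integral_congr_ae ?_
      filter_upwards [ae_restrict_of_ae_restrict_of_subset (Ioo_subset_Ioo_right ht.2) hall,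
        ae_restrict_of_ae_restrict_of_subset (Ioo_subset_Ioo_right ht.2) hρV] with s h1 h2
      have h3 := h1 _ h2
      rw [inner_add_left] at h3 ⊢
      rw [inner_add_right, real_inner_comm (σ s), real_inner_comm (η s)]
      linarith
    rw [hint, intervalIntegral.integral_add hc1 hc2, ← he1] at hE
    have hle : ∫ s in (0 : ℝ)..t, ⟪Q s + η s, (ρ s).1⟫_ℝ
        ≤ ∫ s in (0 : ℝ)..t, k s * ‖(ρ s).1‖ :=
      intervalIntegral.integral_mono_on ht.1 hc2 hc3 fun s _ => real_inner_le_norm _ _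
    rw [hP2] at hκP
    rw [Real.sq_sqrt (by positivity)]
    linarith
  intro t ht
  have h := le_add_integral_of_sq_le (Real.sqrt_nonneg _) hρ1c.norm hkc
    (fun _ _ => norm_nonneg _) (fun _ _ => norm_nonneg _) key t ht
  refine h.trans (add_le_add_left ?_ _)
  refine Real.sqrt_le_iff.2 ⟨by positivity, ?_⟩
  nlinarith [mul_nonneg (norm_nonneg r₀) hκ0]

/-! ### Functions that are piecewise smooth on the time grid -/

theorem stepIdx_of_mem_Ioc {τ t : ℝ} (hτ : 0 < τ) {n : ℕ} (ht : t ∈ Ioc (n * τ) ((n + 1) * τ)) :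
    stepIdx τ t = n + 1 := by
  have h : ⌈t / τ⌉₊ = n + 1 := by
    rw [Nat.ceil_eq_iff (by omega)]
    refine ⟨?_, ?_⟩
    · rw [lt_div_iff₀ hτ]; simpa using ht.1
    · rw [div_le_iff₀ hτ]; push_cast; exact ht.2
  rw [stepIdx, h]; omega

theorem stepIdx_of_le {τ t : ℝ} (hτ : 0 < τ) (ht : t ≤ τ) : stepIdx τ t = 1 := by
  have h : ⌈t / τ⌉₊ ≤ 1 := by
    rw [Nat.ceil_le, div_le_iff₀ hτ]; simpa using ht
  rw [stepIdx]; omega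

theorem one_le_stepIdx (τ t : ℝ) : 1 ≤ stepIdx τ t := le_max_left _ _

section Piecewise

variable {X : Type*} {τ : ℝ} {p : ℕ → ℝ → X}

theorem piecewise_eq_of_mem_Icc (hτ : 0 < τ)
    (hp : ∀ n : ℕ, 1 ≤ n → p n (n * τ) = p (n + 1) (n * τ)) {n : ℕ} {t : ℝ}
    (ht : t ∈ Icc (n * τ) ((n + 1) * τ)) : p (stepIdx τ t) t = p (n + 1) t := by
  rcases ht.1.eq_or_lt with h | h
  · cases n with
    | zero => rw [stepIdx_of_le hτ (by rw [← h]; simpa using hτ.le)]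
    | succ m =>
      have : stepIdx τ t = m + 1 := stepIdx_of_mem_Ioc hτ (by
        rw [← h]; push_cast; exact ⟨by nlinarith, le_rfl⟩)
      rw [this, ← h]
      exact hp (m + 1) (by omega)
  · rw [stepIdx_of_mem_Ioc hτ ⟨h, ht.2⟩]

/-- A time interval contains its right end point, so at a node the value comes from the left piece;
as the values match, the next piece is valid from the node onwards. The first piece is used for all
`t ≤ τ`, negative times included, so that `0` is not a break point. -/
theorem piecewise_eventuallyEq (hτ : 0 < τ)
    (hp : ∀ n : ℕ, 1 ≤ n → p n (n * τ) = p (n + 1) (n * τ)) (t : ℝ) :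
    ((fun s => p (stepIdx τ s) s) =ᶠ[𝓝 t] p (stepIdx τ t)) ∨
      (t = stepIdx τ t * τ ∧ (fun s => p (stepIdx τ s) s) =ᶠ[𝓝[≤] t] p (stepIdx τ t) ∧
        (fun s => p (stepIdx τ s) s) =ᶠ[𝓝[≥] t] p (stepIdx τ t + 1)) := by
  rcases lt_or_ge t τ with h | h
  · left
    rw [stepIdx_of_le hτ h.le]
    filter_upwards [Iio_mem_nhds h] with s hs
    rw [stepIdx_of_le hτ (le_of_lt hs)]
  · obtain ⟨n, hn⟩ : ∃ n : ℕ, t ∈ Ioc (n * τ) ((n + 1) * τ) := by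
      have h1 : 1 ≤ ⌈t / τ⌉₊ := Nat.one_le_ceil_iff.2 (div_pos (hτ.trans_le h) hτ)
      obtain ⟨n, hn⟩ := Nat.exists_eq_add_of_le' h1
      have := (Nat.ceil_eq_iff (by omega)).1 hn
      refine ⟨n, ?_, ?_⟩
      · have := this.1; rw [lt_div_iff₀ hτ] at this; simpa using this
      · have := this.2; rw [div_le_iff₀ hτ] at this; push_cast at this; exact this
    rw [stepIdx_of_mem_Ioc hτ hn]
    rcases hn.2.lt_or_eq with h2 | h2
    · left
      filter_upwards [Ioo_mem_nhds hn.1 h2] with s hs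
      rw [stepIdx_of_mem_Ioc hτ ⟨hs.1, hs.2.le⟩]
    · right
      refine ⟨by push_cast; exact h2, ?_, ?_⟩
      · filter_upwards [Ioc_mem_nhdsLE hn.1] with s hs
        rw [stepIdx_of_mem_Ioc hτ ⟨hs.1, hs.2.trans hn.2⟩]
      · have hlt : t < t + τ := by linarith
        filter_upwards [Ico_mem_nhdsGE hlt] with s hs
        refine piecewise_eq_of_mem_Icc hτ hp ⟨?_, ?_⟩
        · push_cast; linarith [hs.1]
        · push_cast; linarith [hs.2.le]

theorem continuous_piecewise [TopologicalSpace X] (hτ : 0 < τ)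
    (hp : ∀ n : ℕ, 1 ≤ n → p n (n * τ) = p (n + 1) (n * τ))
    (hc : ∀ n : ℕ, 1 ≤ n → Continuous (p n)) : Continuous fun s => p (stepIdx τ s) s := by
  rw [continuous_iff_continuousAt]
  intro t
  have h1 := one_le_stepIdx τ t
  rcases piecewise_eventuallyEq hτ hp t with h | ⟨ht, hl, hr⟩
  · exact (hc _ h1).continuousAt.congr h.symm
  · rw [continuousAt_iff_continuous_left_right]
    refine ⟨(hc _ h1).continuousWithinAt.congr_of_eventuallyEq hl rfl,
      (hc _ (h1.trans (Nat.le_succ _))).continuousWithinAt.congr_of_eventuallyEq hr ?_⟩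
    have := hp _ h1
    rwa [← ht] at this

/-- Equal one-sided derivatives glue together. Differentiability holds at the nodes and at `0` as
well, so `deriv` of a reconstruction is a genuine derivative at every time. -/
theorem hasDerivAt_piecewise [NormedAddCommGroup X] [NormedSpace ℝ X] {p' : ℕ → ℝ → X}
    (hτ : 0 < τ) (hp : ∀ n : ℕ, 1 ≤ n → p n (n * τ) = p (n + 1) (n * τ))
    (hp' : ∀ n : ℕ, 1 ≤ n → p' n (n * τ) = p' (n + 1) (n * τ))
    (hd : ∀ n : ℕ, 1 ≤ n → ∀ t, HasDerivAt (p n) (p' n t) t) (t : ℝ) :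
    HasDerivAt (fun s => p (stepIdx τ s) s) (p' (stepIdx τ t) t) t := by
  have h1 := one_le_stepIdx τ t
  rcases piecewise_eventuallyEq hτ hp t with h | ⟨ht, hl, hr⟩
  · exact (hd _ h1 t).congr_of_eventuallyEq h
  · have hpt := hp _ h1
    have hpt' := hp' _ h1
    rw [← ht] at hpt hpt'
    have h2 := (hd _ h1 t).hasDerivWithinAt.congr_of_eventuallyEq hl rfl
    have h3 := (hd _ (h1.trans (Nat.le_succ _)) t).hasDerivWithinAt.congr_of_eventuallyEq hr hpt
    rw [← hpt'] at h3
    have h4 := h2.union h3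
    rwa [Iic_union_Ici, hasDerivWithinAt_univ] at h4

end Piecewise

/-! ### The cubic reconstruction in time -/

section Recon

variable {X : Type*} [NormedAddCommGroup X] [NormedSpace ℝ X] {τ : ℝ} (x : ℕ → X) (dx₀ : X)

/-- The polynomial that represents `cubicRecon` on the `n`th time interval. -/
noncomputable def cubicPiece (τ : ℝ) (n : ℕ) (t : ℝ) : X :=
  ((t - (n - 1) * τ) / τ) • x n + ((n * τ - t) / τ) • x (n - 1)
    - ((t - (n - 1) * τ) * (n * τ - t) ^ 2 / τ) • bdiff2 τ x dx₀ n

/-- The derivative of `cubicPiece`. -/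
noncomputable def cubicDerivPiece (τ : ℝ) (n : ℕ) (t : ℝ) : X :=
  bdiff τ x dx₀ n
    - (((n * τ - t) ^ 2 - 2 * ((t - (n - 1) * τ) * (n * τ - t))) / τ) • bdiff2 τ x dx₀ n

/-- The derivative of `cubicRecon`. -/
noncomputable def cubicReconDeriv (τ t : ℝ) : X := cubicDerivPiece x dx₀ τ (stepIdx τ t) t

/-- The polynomial that represents `evoFun` on the `n`th time interval. -/
noncomputable def evoPiece (τ : ℝ) (n : ℕ) (t : ℝ) : X :=
  ((n * τ - t) ^ 2 / 2) • bdiff τ x dx₀ n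
    - ((n * τ - t) ^ 4 / (4 * τ) - (n * τ - t) ^ 3 / 3) • bdiff2 τ x dx₀ n - evoConst τ x dx₀ n

variable {x dx₀}

theorem bdiff_succ_eq (hτ : 0 < τ) (n : ℕ) :
    bdiff τ x dx₀ (n + 1) = bdiff τ x dx₀ n + τ • bdiff2 τ x dx₀ (n + 1) := by
  rw [bdiff2, Nat.add_sub_cancel, smul_smul, mul_inv_cancel₀ hτ.ne', one_smul]
  abel

theorem cubicPiece_right (hτ : 0 < τ) (n : ℕ) : cubicPiece x dx₀ τ n (n * τ) = x n := by
  have h : (n * τ - (n - 1) * τ) / τ = 1 := by field_simp; ring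
  simp [cubicPiece, h]

theorem cubicPiece_left (hτ : 0 < τ) (n : ℕ) : cubicPiece x dx₀ τ (n + 1) (n * τ) = x n := by
  have h : (((n : ℝ) + 1) * τ - n * τ) / τ = 1 := by field_simp; ring
  simp [cubicPiece, h]

theorem cubicDerivPiece_right (n : ℕ) :
    cubicDerivPiece x dx₀ τ n (n * τ) = bdiff τ x dx₀ n := by
  simp [cubicDerivPiece]

/-- The reason for the cubic correction: it has a double zero at the right node, and at the left
node its slope `τ ∂²xⁿ⁺¹` turns the slope `∂xⁿ⁺¹` of the linear interpolant into `∂xⁿ`. Adjacent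
pieces therefore fit together in a `C¹` way. -/
theorem cubicDerivPiece_left (hτ : 0 < τ) (n : ℕ) :
    cubicDerivPiece x dx₀ τ (n + 1) (n * τ) = bdiff τ x dx₀ n := by
  have h : ((((n + 1 : ℕ) : ℝ) * τ - n * τ) ^ 2
      - 2 * ((n * τ - (((n + 1 : ℕ) : ℝ) - 1) * τ) * (((n + 1 : ℕ) : ℝ) * τ - n * τ))) / τ = τ := by
    field_simp; push_cast; ring
  rw [cubicDerivPiece, h, bdiff_succ_eq hτ]
  abel

theorem evoPiece_right (n : ℕ) : evoPiece x dx₀ τ n (n * τ) = - evoConst τ x dx₀ n := by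
  simp [evoPiece]

/-- The increments of `γ` are the ones that make `𝒢` continuous: at the left node the remaining
terms equal `τ²/2 ∂gⁿ⁺¹ + (τ³/3 - τ³/4) ∂²gⁿ⁺¹`, which is `γ_{n+1} - γ_n`. -/
theorem evoPiece_left (hτ : 0 < τ) (n : ℕ) :
    evoPiece x dx₀ τ (n + 1) (n * τ) = - evoConst τ x dx₀ n := by
  have h : (((n + 1 : ℕ) : ℝ) * τ - n * τ) = τ := by push_cast; ring
  have hτ' := hτ.ne'
  rw [evoPiece, h, evoConst]
  match_scalars <;> field_simp <;> ring

theorem hasDerivAt_cubicPiece (hτ : 0 < τ) {n : ℕ} (hn : 1 ≤ n) (t : ℝ) :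
    HasDerivAt (cubicPiece x dx₀ τ n) (cubicDerivPiece x dx₀ τ n t) t := by
  obtain ⟨m, rfl⟩ := Nat.exists_eq_add_of_le' hn
  have h1 : HasDerivAt (fun t : ℝ => t - (((m + 1 : ℕ) : ℝ) - 1) * τ) 1 t :=
    (hasDerivAt_id t).sub_const _
  have h2 : HasDerivAt (fun t : ℝ => ((m + 1 : ℕ) : ℝ) * τ - t) (-1) t :=
    (hasDerivAt_id t).const_sub _
  have h := (((h1.div_const τ).smul_const (x (m + 1))).add
    ((h2.div_const τ).smul_const (x (m + 1 - 1)))).sub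
    (((h1.mul (h2.pow 2)).div_const τ).smul_const (bdiff2 τ x dx₀ (m + 1)))
  refine h.congr_deriv ?_
  simp only [cubicDerivPiece, bdiff, Nat.add_sub_cancel, Pi.pow_apply]
  match_scalars
  · field_simp
  · field_simp
  · field_simp
    push_cast
    ring

/-- The second derivative of the reconstruction on the `n`th interval. -/
theorem hasDerivAt_cubicDerivPiece (hτ : 0 < τ) (n : ℕ) (t : ℝ) :
    HasDerivAt (cubicDerivPiece x dx₀ τ n) ((1 + timeWeight τ n t) • bdiff2 τ x dx₀ n) t := by
  have h1 : HasDerivAt (fun t : ℝ => t - ((n : ℝ) - 1) * τ) 1 t := (hasDerivAt_id t).sub_const _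
  have h2 : HasDerivAt (fun t : ℝ => (n : ℝ) * τ - t) (-1) t := (hasDerivAt_id t).const_sub _
  have h := ((((h2.pow 2).sub ((h1.mul h2).const_mul 2)).div_const τ).smul_const
    (bdiff2 τ x dx₀ n)).const_sub (bdiff τ x dx₀ n)
  refine h.congr_deriv ?_
  rw [← neg_smul]
  congr 1
  simp only [timeWeight]
  field_simp
  norm_num
  ring

theorem hasDerivAt_evoPiece (hτ : 0 < τ) {n : ℕ} (hn : 1 ≤ n) (t : ℝ) :
    HasDerivAt (evoPiece x dx₀ τ n) (cubicPiece x dx₀ τ n t - x n) t := by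
  obtain ⟨m, rfl⟩ := Nat.exists_eq_add_of_le' hn
  have h2 : HasDerivAt (fun t : ℝ => ((m + 1 : ℕ) : ℝ) * τ - t) (-1) t :=
    (hasDerivAt_id t).const_sub _
  have h := ((((h2.pow 2).div_const 2).smul_const (bdiff τ x dx₀ (m + 1))).sub
    ((((h2.pow 4).div_const (4 * τ)).sub ((h2.pow 3).div_const 3)).smul_const
      (bdiff2 τ x dx₀ (m + 1)))).sub_const (evoConst τ x dx₀ (m + 1))
  refine h.congr_deriv ?_
  have e : x (m + 1) = x m + τ • bdiff τ x dx₀ (m + 1) := by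
    rw [bdiff, smul_smul, mul_inv_cancel₀ hτ.ne', one_smul]; abel
  simp only [cubicPiece, Nat.add_sub_cancel]
  rw [e]
  match_scalars <;> (try field_simp) <;> (try push_cast) <;> ring

theorem hasDerivAt_cubicRecon (hτ : 0 < τ) (t : ℝ) :
    HasDerivAt (cubicRecon τ x dx₀) (cubicReconDeriv x dx₀ τ t) t :=
  hasDerivAt_piecewise (p := cubicPiece x dx₀ τ) hτ
    (fun n _ => by rw [cubicPiece_right hτ, cubicPiece_left hτ])
    (fun n _ => by rw [cubicDerivPiece_right, cubicDerivPiece_left hτ])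
    (fun n hn => hasDerivAt_cubicPiece hτ hn) t

theorem continuous_cubicRecon (hτ : 0 < τ) : Continuous (cubicRecon τ x dx₀) :=
  continuous_iff_continuousAt.2 fun t => (hasDerivAt_cubicRecon hτ t).continuousAt

theorem continuous_cubicReconDeriv (hτ : 0 < τ) : Continuous (cubicReconDeriv x dx₀ τ) :=
  continuous_piecewise (p := cubicDerivPiece x dx₀ τ) hτ
    (fun n _ => by rw [cubicDerivPiece_right, cubicDerivPiece_left hτ])
    fun n _ => continuous_iff_continuousAt.2 fun t =>
      (hasDerivAt_cubicDerivPiece hτ n t).continuousAt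

theorem continuous_evoFun (hτ : 0 < τ) : Continuous (evoFun τ x dx₀) :=
  continuous_piecewise (p := evoPiece x dx₀ τ) hτ
    (fun n _ => by rw [evoPiece_right, evoPiece_left hτ])
    fun n hn => continuous_iff_continuousAt.2 fun t => (hasDerivAt_evoPiece hτ hn t).continuousAt

theorem cubicRecon_eq_of_mem_Icc (hτ : 0 < τ) {n : ℕ} {t : ℝ}
    (ht : t ∈ Icc (n * τ) ((n + 1) * τ)) :
    cubicRecon τ x dx₀ t = cubicPiece x dx₀ τ (n + 1) t :=
  piecewise_eq_of_mem_Icc (p := cubicPiece x dx₀ τ) hτ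
    (fun n _ => by rw [cubicPiece_right hτ, cubicPiece_left hτ]) ht

theorem cubicReconDeriv_eq_of_mem_Icc (hτ : 0 < τ) {n : ℕ} {t : ℝ}
    (ht : t ∈ Icc (n * τ) ((n + 1) * τ)) :
    cubicReconDeriv x dx₀ τ t = cubicDerivPiece x dx₀ τ (n + 1) t :=
  piecewise_eq_of_mem_Icc (p := cubicDerivPiece x dx₀ τ) hτ
    (fun n _ => by rw [cubicDerivPiece_right, cubicDerivPiece_left hτ]) ht

theorem evoFun_eq_of_mem_Icc (hτ : 0 < τ) {n : ℕ} {t : ℝ}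
    (ht : t ∈ Icc (n * τ) ((n + 1) * τ)) :
    evoFun τ x dx₀ t = evoPiece x dx₀ τ (n + 1) t :=
  piecewise_eq_of_mem_Icc (p := evoPiece x dx₀ τ) hτ
    (fun n _ => by rw [evoPiece_right, evoPiece_left hτ]) ht

theorem cubicRecon_node (hτ : 0 < τ) (n : ℕ) : cubicRecon τ x dx₀ (n * τ) = x n := by
  rw [cubicRecon_eq_of_mem_Icc (n := n) hτ ⟨le_rfl, by nlinarith⟩, cubicPiece_left hτ]

theorem cubicReconDeriv_node (hτ : 0 < τ) (n : ℕ) :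
    cubicReconDeriv x dx₀ τ (n * τ) = bdiff τ x dx₀ n := by
  rw [cubicReconDeriv_eq_of_mem_Icc (n := n) hτ ⟨le_rfl, by nlinarith⟩, cubicDerivPiece_left hτ]

theorem evoFun_node (hτ : 0 < τ) (n : ℕ) : evoFun τ x dx₀ (n * τ) = - evoConst τ x dx₀ n := by
  rw [evoFun_eq_of_mem_Icc (n := n) hτ ⟨le_rfl, by nlinarith⟩, evoPiece_left hτ]

/-- The reconstruction commutes with linear maps. -/
theorem map_cubicRecon {Y : Type*} [NormedAddCommGroup Y] [NormedSpace ℝ Y] (L : X →ₗ[ℝ] Y)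
    (t : ℝ) : L (cubicRecon τ x dx₀ t) = cubicRecon τ (fun n => L (x n)) (L dx₀) t := by
  have h : ∀ n, L (bdiff τ x dx₀ n) = bdiff τ (fun n => L (x n)) (L dx₀) n := by
    intro n; cases n <;> simp [bdiff]
  simp [cubicRecon, bdiff2, h]

end Recon

/-! ### Primitives of functions of mean zero -/

/-- Integration by parts against `t - b`, which vanishes at `b` while the primitive vanishes at `a`.
Absolute continuity of the primitive suffices, so `q` need not be continuous. -/
theorem integral_primitive_left {q : ℝ → ℝ} {a b : ℝ} (hq : IntervalIntegrable q volume a b) :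
    ∫ t in a..b, ∫ s in a..t, q s = ∫ s in a..b, (b - s) * q s := by
  have h1 := hq.absolutelyContinuousOnInterval_intervalIntegral (c := a) left_mem_uIcc
  have h2 : AbsolutelyContinuousOnInterval (fun t : ℝ => t - b) a b :=
    (contDiff_id.sub contDiff_const).contDiffOn.absolutelyContinuousOnInterval
  have h := h1.integral_mul_deriv_eq_deriv_mul h2
  have hd : ∀ t : ℝ, deriv (fun t : ℝ => t - b) t = 1 := fun t =>
    ((hasDerivAt_id t).sub_const b).deriv
  simp only [hd, mul_one, sub_self, mul_zero, intervalIntegral.integral_same, zero_mul,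
    zero_sub] at h
  rw [h, ← intervalIntegral.integral_neg]
  refine intervalIntegral.integral_congr_ae ?_
  filter_upwards [hq.ae_hasDerivAt_integral] with x hx hxm
  rw [(hx (uIoc_subset_uIcc hxm) a left_mem_uIcc).deriv]
  ring

theorem integral_primitive_right {q : ℝ → ℝ} {a b : ℝ} (hq : IntervalIntegrable q volume a b) :
    ∫ t in a..b, ∫ s in t..b, q s = ∫ s in a..b, (s - a) * q s := by
  have hsub : ∀ t ∈ uIcc a b, IntervalIntegrable q volume a t := fun t ht =>
    hq.mono_set (uIcc_subset_uIcc_left ht)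
  have h1 : ∫ t in a..b, ∫ s in t..b, q s
      = ∫ t in a..b, ((∫ s in a..b, q s) - ∫ s in a..t, q s) :=
    intervalIntegral.integral_congr fun t ht =>
      (intervalIntegral.integral_interval_sub_left hq (hsub t ht)).symm
  have h2 : ∫ s in a..b, (s - a) * q s = ∫ s in a..b, ((b - a) * q s - (b - s) * q s) :=
    intervalIntegral.integral_congr fun t _ => by ring
  rw [h1, h2, intervalIntegral.integral_sub, intervalIntegral.integral_sub,
    integral_primitive_left hq, intervalIntegral.integral_const,
    intervalIntegral.integral_const_mul, smul_eq_mul]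
  · exact hq.const_mul _
  · exact hq.continuousOn_mul (by fun_prop)
  · simp
  · exact (intervalIntegral.continuousOn_primitive_interval' hq left_mem_uIcc).intervalIntegrable

/-- The Cauchy-Schwarz inequality, from the discriminant of the nonnegative quadratic `l ↦ ∫ (q - l
|s - m|)²`; the constant is `∫ (s - m)² = (b - a)³ / 12`. -/
theorem integral_abs_mul_le {q : ℝ → ℝ} {a b : ℝ} (hab : a ≤ b)
    (hq : IntervalIntegrable q volume a b)
    (hq2 : IntervalIntegrable (fun s => q s ^ 2) volume a b) :
    (∫ s in a..b, |s - (a + b) / 2| * q s) ^ 2 ≤ (b - a) ^ 3 / 12 * ∫ s in a..b, q s ^ 2 := by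
  set m := (a + b) / 2
  have hI : IntervalIntegrable (fun s => |s - m| * q s) volume a b :=
    hq.continuousOn_mul (by fun_prop)
  have hm : ∫ s in a..b, (s - m) ^ 2 = (b - a) ^ 3 / 12 := by
    rw [intervalIntegral.integral_comp_sub_right (fun s => s ^ 2) m, integral_pow]
    simp only [m]; norm_num; ring
  have hquad : ∀ l : ℝ, 0 ≤ (b - a) ^ 3 / 12 * (l * l)
      + (-2 * ∫ s in a..b, |s - m| * q s) * l + ∫ s in a..b, q s ^ 2 := by
    intro l
    have h0 : 0 ≤ ∫ s in a..b, (q s - l * |s - m|) ^ 2 :=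
      intervalIntegral.integral_nonneg hab fun s _ => sq_nonneg _
    have h1 : ∫ s in a..b, (q s - l * |s - m|) ^ 2
        = ∫ s in a..b, (q s ^ 2 + (-2 * l) * (|s - m| * q s) + l ^ 2 * (s - m) ^ 2) :=
      intervalIntegral.integral_congr fun s _ => by
        have := sq_abs (s - m); rw [← this]; ring
    rw [h1, intervalIntegral.integral_add (hq2.add (hI.const_mul _))
      (Continuous.intervalIntegrable (by fun_prop) _ _),
      intervalIntegral.integral_add hq2 (hI.const_mul _), intervalIntegral.integral_const_mul,
      intervalIntegral.integral_const_mul, hm] at h0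
    linarith
  have := discrim_le_zero hquad
  rw [discrim] at this
  linarith

/-- The primitive of a function of mean zero on an interval of length `τ`. The proof gives the
constant `1 / √12 ≤ 1 / π`. -/
theorem integral_norm_primitive_le {X : Type*} [NormedAddCommGroup X] [NormedSpace ℝ X]
    {h : ℝ → X} {a b : ℝ} (hab : a ≤ b) (hh : IntervalIntegrable h volume a b)
    (hh2 : IntervalIntegrable (fun s => ‖h s‖ ^ 2) volume a b) (h0 : ∫ s in a..b, h s = 0) :
    ∫ t in a..b, ‖∫ s in a..t, h s‖
      ≤ 1 / Real.pi * √(∫ s in a..b, (b - a) ^ 3 * ‖h s‖ ^ 2) := by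
  set m := (a + b) / 2 with hm
  have ham : a ≤ m := by rw [hm]; linarith
  have hmb : m ≤ b := by rw [hm]; linarith
  have hmI : m ∈ uIcc a b := by rw [uIcc_of_le hab]; exact ⟨ham, hmb⟩
  have hc : ContinuousOn (fun t => ‖∫ s in a..t, h s‖) (uIcc a b) :=
    (intervalIntegral.continuousOn_primitive_interval' hh left_mem_uIcc).norm
  have hl : uIcc a m ⊆ uIcc a b := uIcc_subset_uIcc_left hmI
  have hr : uIcc m b ⊆ uIcc a b := uIcc_subset_uIcc_right hmI
  have hn := hh.norm
  have hwI : IntervalIntegrable (fun s => |s - m| * ‖h s‖) volume a b :=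
    hn.continuousOn_mul (by fun_prop)
  have h1 : ∫ t in a..m, ‖∫ s in a..t, h s‖ ≤ ∫ s in a..m, |s - m| * ‖h s‖ := by
    calc ∫ t in a..m, ‖∫ s in a..t, h s‖ ≤ ∫ t in a..m, ∫ s in a..t, ‖h s‖ := by
          refine intervalIntegral.integral_mono_on ham (hc.mono hl).intervalIntegrable
            (intervalIntegral.continuousOn_primitive_interval' (hn.mono_set hl)
              left_mem_uIcc).intervalIntegrable fun t ht => ?_
          exact intervalIntegral.norm_integral_le_integral_norm ht.1
      _ = ∫ s in a..m, (m - s) * ‖h s‖ := integral_primitive_left (hn.mono_set hl)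
      _ = _ := intervalIntegral.integral_congr fun s hs => by
          rw [uIcc_of_le ham] at hs
          rw [abs_of_nonpos (by linarith [hs.2]), neg_sub]
  -- Beyond the midpoint the mean value zero allows the primitive to be taken from the right end
  -- point, so the weight on `‖h s‖` is the distance to the midpoint on both halves.
  have h2 : ∫ t in m..b, ‖∫ s in a..t, h s‖ ≤ ∫ s in m..b, |s - m| * ‖h s‖ := by
    calc ∫ t in m..b, ‖∫ s in a..t, h s‖ ≤ ∫ t in m..b, ∫ s in t..b, ‖h s‖ := by
          refine intervalIntegral.integral_mono_on hmb (hc.mono hr).intervalIntegrable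
            (?_ : ContinuousOn _ _).intervalIntegrable fun t ht => ?_
          · have hp := (intervalIntegral.continuousOn_primitive_interval' (hn.mono_set hr)
              (right_mem_uIcc (a := m) (b := b))).neg
            refine hp.congr fun t _ => ?_
            rw [Pi.neg_apply, intervalIntegral.integral_symm]
          · have ht' : t ∈ uIcc a b := by rw [uIcc_of_le hab]; exact ⟨ham.trans ht.1, ht.2⟩
            have h3 : ∫ s in a..t, h s = - ∫ s in t..b, h s := by
              rw [eq_neg_iff_add_eq_zero, intervalIntegral.integral_add_adjacent_intervals
                (hh.mono_set (uIcc_subset_uIcc_left ht'))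
                (hh.mono_set (uIcc_subset_uIcc_right ht')), h0]
            rw [h3, norm_neg]
            exact intervalIntegral.norm_integral_le_integral_norm ht.2
      _ = ∫ s in m..b, (s - m) * ‖h s‖ := integral_primitive_right (hn.mono_set hr)
      _ = _ := intervalIntegral.integral_congr fun s hs => by
          rw [uIcc_of_le hmb] at hs
          rw [abs_of_nonneg (by linarith [hs.1])]
  have h3 : ∫ t in a..b, ‖∫ s in a..t, h s‖ ≤ ∫ s in a..b, |s - m| * ‖h s‖ := by
    rw [← intervalIntegral.integral_add_adjacent_intervals (hc.mono hl).intervalIntegrable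
      (hc.mono hr).intervalIntegrable, ← intervalIntegral.integral_add_adjacent_intervals
      (hwI.mono_set hl) (hwI.mono_set hr)]
    exact add_le_add h1 h2
  refine h3.trans ?_
  have h4 := integral_abs_mul_le hab hn hh2
  have h5 : 0 ≤ ∫ s in a..b, ‖h s‖ ^ 2 :=
    intervalIntegral.integral_nonneg hab fun s _ => sq_nonneg _
  have h6 : 0 ≤ (b - a) ^ 3 := pow_nonneg (by linarith) 3
  have hpi : Real.pi ^ 2 ≤ 12 := by nlinarith [Real.pi_lt_d2, Real.pi_pos]
  rw [intervalIntegral.integral_const_mul]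
  refine abs_le_of_sq_le_sq' ?_ (by positivity) |>.2
  refine h4.trans ?_
  rw [mul_pow, Real.sq_sqrt (mul_nonneg h6 h5), div_pow, one_pow, div_mul_eq_mul_div,
    div_mul_eq_mul_div, one_mul]
  exact div_le_div_of_nonneg_left (mul_nonneg h6 h5) (by positivity) hpi

/-! ### The integrated residual of the fully discrete scheme -/

section Residual

variable {X : Type*} [NormedAddCommGroup X] [NormedSpace ℝ X] {τ : ℝ} {N : ℕ}
  {x g : ℕ → X} {dx₀ dg₀ : X} {f : ℝ → X} {Pr : ℕ → X →L[ℝ] X}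

/-- The time integral of the residual `∂ₜₜ x_N + g_N - f`. -/
noncomputable def integratedResidual (x : ℕ → X) (dx₀ : X) (g : ℕ → X) (dg₀ : X) (f : ℝ → X)
    (τ t : ℝ) : X :=
  cubicReconDeriv x dx₀ τ t - dx₀ + (∫ s in (0 : ℝ)..t, cubicRecon τ g dg₀ s)
    - ∫ s in (0 : ℝ)..t, f s

theorem cell_subset (hτ : 0 < τ) {n : ℕ} (hn : n < N) :
    Icc (n * τ) ((n + 1) * τ) ⊆ Icc 0 (N * τ) := by
  have h : (n : ℝ) + 1 ≤ N := by exact_mod_cast hn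
  exact Icc_subset_Icc (by positivity) (by gcongr)

theorem cell_le (hτ : 0 < τ) (n : ℕ) : (n : ℝ) * τ ≤ (n + 1) * τ := by nlinarith

theorem continuous_timeWeight (n : ℕ) : Continuous (timeWeight τ n) := by
  unfold timeWeight; fun_prop

theorem integral_timeWeight (n : ℕ) :
    ∫ s in (n * τ)..((n + 1) * τ), timeWeight τ (n + 1) s = 0 := by
  simp only [timeWeight]
  rw [intervalIntegral.integral_const_mul,
    intervalIntegral.integral_sub (by simp) (by simp), integral_id,
    intervalIntegral.integral_const, smul_eq_mul]
  push_cast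
  ring

theorem intervalIntegrable_cell {Y : Type*} [NormedAddCommGroup Y] (hτ : 0 < τ) {q : ℝ → Y}
    (hq : IntervalIntegrable q volume 0 (N * τ)) {n : ℕ} (hn : n < N) {s t : ℝ}
    (hs : s ∈ Icc (n * τ) ((n + 1) * τ)) (ht : t ∈ Icc (n * τ) ((n + 1) * τ)) :
    IntervalIntegrable q volume s t := by
  refine hq.mono_set (uIcc_subset_uIcc ?_ ?_) <;> rw [uIcc_of_le (by positivity)]
  · exact cell_subset hτ hn hs
  · exact cell_subset hτ hn ht

variable [CompleteSpace X]

theorem integral_timeAverage_sub (hτ : 0 < τ)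
    (hf : IntervalIntegrable f volume 0 (N * τ)) {n : ℕ} (hn : n < N) :
    ∫ s in (n * τ)..((n + 1) * τ), (timeAverage τ f (n + 1) - f s) = 0 := by
  rw [intervalIntegral.integral_sub (by simp) (intervalIntegrable_cell hτ hf hn
    (left_mem_Icc.2 (cell_le hτ n)) (right_mem_Icc.2 (cell_le hτ n))),
    intervalIntegral.integral_const, timeAverage, smul_smul]
  have : ((n + 1) * τ - n * τ) * τ⁻¹ = 1 := by field_simp; ring
  rw [this, one_smul, sub_self]

/-- The increments of the integrated residual within a time interval. -/
theorem integratedResidual_sub (hτ : 0 < τ) (hf : IntervalIntegrable f volume 0 (N * τ))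
    {n : ℕ} (hn : n < N)
    (hg : g (n + 1) = timeAverage τ f (n + 1) - Pr (n + 1) (bdiff2 τ x dx₀ (n + 1)))
    {t : ℝ} (ht : t ∈ Icc (n * τ) ((n + 1) * τ)) :
    integratedResidual x dx₀ g dg₀ f τ t - integratedResidual x dx₀ g dg₀ f τ (n * τ)
      = (cubicReconDeriv x dx₀ τ t - Pr (n + 1) (cubicReconDeriv x dx₀ τ t))
        - (bdiff τ x dx₀ n - Pr (n + 1) (bdiff τ x dx₀ n))
        + (evoFun τ g dg₀ t - evoFun τ g dg₀ (n * τ))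
        + (∫ s in (n * τ)..t, (timeAverage τ f (n + 1) - f s))
        + ∫ s in (n * τ)..t, timeWeight τ (n + 1) s • Pr (n + 1) (bdiff2 τ x dx₀ (n + 1)) := by
  have hl := left_mem_Icc.2 (cell_le hτ n)
  have hNτ : (0 : ℝ) ≤ N * τ := by positivity
  have hz : ∀ s ∈ Icc (n * τ) ((n + 1) * τ), IntervalIntegrable f volume 0 s := fun s hs =>
    hf.mono_set (uIcc_subset_uIcc left_mem_uIcc
      (by rw [uIcc_of_le hNτ]; exact cell_subset hτ hn hs))
  have hfd : (∫ s in (0 : ℝ)..t, f s) - ∫ s in (0 : ℝ)..(n * τ), f s = ∫ s in (n * τ)..t, f s :=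
    intervalIntegral.integral_interval_sub_left (hz t ht) (hz _ hl)
  have hgc : Continuous (cubicRecon τ g dg₀) := continuous_cubicRecon hτ
  have hgd : (∫ s in (0 : ℝ)..t, cubicRecon τ g dg₀ s)
      - ∫ s in (0 : ℝ)..(n * τ), cubicRecon τ g dg₀ s
      = ∫ s in (n * τ)..t, cubicRecon τ g dg₀ s :=
    intervalIntegral.integral_interval_sub_left (hgc.intervalIntegrable _ _)
      (hgc.intervalIntegrable _ _)
  have hsub : ∀ s ∈ uIcc (n * τ) t, s ∈ Icc (n * τ) ((n + 1) * τ) := fun s hs => by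
    rw [uIcc_of_le ht.1] at hs
    exact ⟨hs.1, hs.2.trans ht.2⟩
  -- `𝒢` is a primitive of `g_N - gⁿ⁺¹` on this interval, which leaves the constant `gⁿ⁺¹` to be
  -- integrated.
  have hge : ∫ s in (n * τ)..t, cubicRecon τ g dg₀ s
      = evoFun τ g dg₀ t - evoFun τ g dg₀ (n * τ) + (t - n * τ) • g (n + 1) := by
    have h1 : ∫ s in (n * τ)..t, (cubicPiece g dg₀ τ (n + 1) s - g (n + 1))
        = evoPiece g dg₀ τ (n + 1) t - evoPiece g dg₀ τ (n + 1) (n * τ) := by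
      refine intervalIntegral.integral_eq_sub_of_hasDerivAt
        (fun s _ => hasDerivAt_evoPiece hτ (by omega) s) (Continuous.intervalIntegrable ?_ _ _)
      exact (continuous_iff_continuousAt.2 fun s =>
        (hasDerivAt_cubicPiece hτ (by omega) s).continuousAt).sub continuous_const
    have h2 : ∫ s in (n * τ)..t, cubicRecon τ g dg₀ s
        = ∫ s in (n * τ)..t, ((cubicPiece g dg₀ τ (n + 1) s - g (n + 1)) + g (n + 1)) :=
      intervalIntegral.integral_congr fun s hs => by
        simp only [sub_add_cancel]
        exact cubicRecon_eq_of_mem_Icc hτ (hsub s hs)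
    rw [h2, intervalIntegral.integral_add _ (by simp), h1, intervalIntegral.integral_const,
      evoFun_eq_of_mem_Icc hτ ht, evoFun_eq_of_mem_Icc hτ hl]
    exact ((continuous_iff_continuousAt.2 fun s =>
        (hasDerivAt_cubicPiece hτ (by omega) s).continuousAt).sub
        continuous_const).intervalIntegrable _ _
  have hμc : Continuous (timeWeight τ (n + 1)) := continuous_timeWeight _
  have hD : cubicReconDeriv x dx₀ τ t - bdiff τ x dx₀ n
      = ((t - n * τ) + ∫ s in (n * τ)..t, timeWeight τ (n + 1) s) • bdiff2 τ x dx₀ (n + 1) := by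
    have h1 : ∫ s in (n * τ)..t, ((1 + timeWeight τ (n + 1) s) • bdiff2 τ x dx₀ (n + 1))
        = cubicDerivPiece x dx₀ τ (n + 1) t - cubicDerivPiece x dx₀ τ (n + 1) (n * τ) :=
      intervalIntegral.integral_eq_sub_of_hasDerivAt
        (fun s _ => hasDerivAt_cubicDerivPiece hτ (n + 1) s)
        (Continuous.intervalIntegrable (by fun_prop) _ _)
    rw [cubicDerivPiece_left hτ, intervalIntegral.integral_smul_const,
      intervalIntegral.integral_add (by simp) (hμc.intervalIntegrable _ _),
      intervalIntegral.integral_const, smul_eq_mul, mul_one] at h1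
    rw [cubicReconDeriv_eq_of_mem_Icc hτ ht, ← h1]
  -- The projected increment contains `(t - tⁿ) Πⁿ⁺¹ ∂²xⁿ⁺¹`, which cancels the same term of `(t -
  -- tⁿ) gⁿ⁺¹`.
  have hPD := congrArg (Pr (n + 1)) hD
  rw [map_sub, map_smul] at hPD
  rw [intervalIntegral.integral_sub (by simp) (intervalIntegrable_cell hτ hf hn hl ht),
    intervalIntegral.integral_const, intervalIntegral.integral_smul_const, ← hfd]
  rw [hg] at hge
  rw [hge] at hgd
  rw [add_smul, sub_eq_iff_eq_add] at hPD
  rw [sub_eq_iff_eq_add] at hgd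
  rw [hPD, integratedResidual, integratedResidual, cubicReconDeriv_node hτ, hgd, smul_sub]
  abel

/-- The decomposition of the integrated residual into the contributions of the mesh change, the
evolution error, the data oscillation and the time reconstruction. -/
theorem integratedResidual_eq (hτ : 0 < τ) (hf : IntervalIntegrable f volume 0 (N * τ))
    (hg : ∀ n < N, g (n + 1) = timeAverage τ f (n + 1) - Pr (n + 1) (bdiff2 τ x dx₀ (n + 1)))
    (h0 : Pr 0 dx₀ = dx₀) {n : ℕ} (hn : n < N) {t : ℝ} (ht : t ∈ Icc (n * τ) ((n + 1) * τ)) :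
    integratedResidual x dx₀ g dg₀ f τ t
      = (cubicReconDeriv x dx₀ τ t - Pr (n + 1) (cubicReconDeriv x dx₀ τ t))
        + ∑ k ∈ Finset.range (n + 1), (Pr (k + 1) (bdiff τ x dx₀ k) - Pr k (bdiff τ x dx₀ k))
        + evoFun τ g dg₀ t
        + (∫ s in (n * τ)..t, (timeAverage τ f (n + 1) - f s))
        + ∫ s in (n * τ)..t, timeWeight τ (n + 1) s • Pr (n + 1) (bdiff2 τ x dx₀ (n + 1)) := by
  -- At a node the integrals of `f̃ - f` and `μ` over the completed intervals are zero. Passing to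
  -- the next interval replaces `Πⁿ` by `Πⁿ⁺¹` in front of `∂xⁿ`, which produces one new summand.
  -- The induction starts from zero because `Π⁰` fixes `∂x⁰` and `γ₀ = 0`.
  have hnode : integratedResidual x dx₀ g dg₀ f τ (n * τ)
      = bdiff τ x dx₀ n - Pr n (bdiff τ x dx₀ n)
        + ∑ k ∈ Finset.range n, (Pr (k + 1) (bdiff τ x dx₀ k) - Pr k (bdiff τ x dx₀ k))
        + evoFun τ g dg₀ (n * τ) := by
    clear ht
    induction n with
    | zero =>
      rw [evoFun_node hτ, integratedResidual, cubicReconDeriv_node hτ]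
      simp [bdiff, h0, evoConst]
    | succ m ih =>
      have hm : m < N := by omega
      have h1 := integratedResidual_sub (dg₀ := dg₀) hτ hf hm (hg m hm)
        (right_mem_Icc.2 (cell_le hτ m))
      have h2 : ((m + 1 : ℕ) : ℝ) * τ = (m + 1) * τ := by push_cast; ring
      rw [integral_timeAverage_sub hτ hf hm, intervalIntegral.integral_smul_const,
        integral_timeWeight, ih hm, ← h2, cubicReconDeriv_node hτ, sub_eq_iff_eq_add] at h1
      rw [h1, Finset.sum_range_succ]
      simp only [zero_smul]
      abel
  have h1 := integratedResidual_sub (dg₀ := dg₀) hτ hf hn (hg n hn) ht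
  rw [hnode, sub_eq_iff_eq_add] at h1
  rw [h1, Finset.sum_range_succ]
  abel

end Residual

/-! ### Summation of the residual bounds over the time intervals. -/

section ResidualBound

variable {X : Type*} [NormedAddCommGroup X] [NormedSpace ℝ X] {τ : ℝ} {N : ℕ}
  {x g : ℕ → X} {dx₀ dg₀ : X} {f : ℝ → X} {Pr : ℕ → X →L[ℝ] X}

theorem sum_Icc_one_eq_sum_range (F : ℕ → ℝ) (N : ℕ) :
    ∑ n ∈ Finset.Icc 1 N, F n = ∑ n ∈ Finset.range N, F (n + 1) := by
  induction N with
  | zero => simp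
  | succ m ih => rw [Finset.sum_Icc_succ_top (by omega), ih, Finset.sum_range_succ]

/-- A projection change at `tᵏ` contributes on all intervals from `tᵏ` on, of total length `N τ - k
τ`; this is the origin of the weights in the mesh change indicator. -/
theorem sum_sum_range_succ (c : ℕ → ℝ) (τ : ℝ) (N : ℕ) :
    ∑ n ∈ Finset.range N, τ * ∑ k ∈ Finset.range (n + 1), c k
      = ∑ k ∈ Finset.range N, (N * τ - k * τ) * c k := by
  induction N with
  | zero => simp
  | succ m ih =>
    rw [Finset.sum_range_succ, ih, Finset.sum_range_succ, Finset.sum_range_succ, mul_add,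
      Finset.mul_sum, ← add_assoc, ← Finset.sum_add_distrib]
    push_cast
    congr 1
    · exact Finset.sum_congr rfl fun k _ => by ring
    · ring

theorem continuousOn_integratedResidual (hτ : 0 < τ)
    (hf : IntervalIntegrable f volume 0 (N * τ)) :
    ContinuousOn (integratedResidual x dx₀ g dg₀ f τ) (Icc 0 (N * τ)) := by
  have hf' := intervalIntegral.continuousOn_primitive_interval' hf left_mem_uIcc
  rw [uIcc_of_le (by positivity)] at hf'
  refine ContinuousOn.sub (Continuous.continuousOn ?_) hf'
  exact ((continuous_cubicReconDeriv hτ).sub continuous_const).add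
    (intervalIntegral.continuous_primitive
      (fun a b => (continuous_cubicRecon hτ).intervalIntegrable a b) 0)

variable [CompleteSpace X]

/-- The triangle inequality in `integratedResidual_eq`. The last two terms are primitives of
functions of mean zero, and in the last one the projection is dropped since it does not increase
norms. -/
theorem integral_norm_integratedResidual_cell_le (hτ : 0 < τ)
    (hf : IntervalIntegrable f volume 0 (N * τ))
    (hf2 : IntervalIntegrable (fun s => ‖f s‖ ^ 2) volume 0 (N * τ))
    (hPr : ∀ n v, ‖Pr n v‖ ≤ ‖v‖)
    (hg : ∀ n < N, g (n + 1) = timeAverage τ f (n + 1) - Pr (n + 1) (bdiff2 τ x dx₀ (n + 1)))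
    (h0 : Pr 0 dx₀ = dx₀) {n : ℕ} (hn : n < N) :
    ∫ t in (n * τ)..((n + 1) * τ), ‖integratedResidual x dx₀ g dg₀ f τ t‖
      ≤ (∫ t in (n * τ)..((n + 1) * τ),
          ‖cubicReconDeriv x dx₀ τ t - Pr (n + 1) (cubicReconDeriv x dx₀ τ t)‖)
        + τ * ∑ k ∈ Finset.range (n + 1),
            ‖Pr (k + 1) (bdiff τ x dx₀ k) - Pr k (bdiff τ x dx₀ k)‖
        + (∫ t in (n * τ)..((n + 1) * τ), ‖evoFun τ g dg₀ t‖)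
        + 1 / Real.pi * √(∫ t in (n * τ)..((n + 1) * τ),
            τ ^ 3 * ‖timeAverage τ f (n + 1) - f t‖ ^ 2)
        + 1 / Real.pi * √(∫ t in (n * τ)..((n + 1) * τ),
            τ ^ 3 * ‖timeWeight τ (n + 1) t • bdiff2 τ x dx₀ (n + 1)‖ ^ 2) := by
  have hle := cell_le hτ n
  have hl := left_mem_Icc.2 hle
  have hr := right_mem_Icc.2 hle
  have hlen : ((n : ℝ) + 1) * τ - n * τ = τ := by ring
  set a := (n : ℝ) * τ
  set b := ((n : ℝ) + 1) * τ
  set S := ∑ k ∈ Finset.range (n + 1), (Pr (k + 1) (bdiff τ x dx₀ k) - Pr k (bdiff τ x dx₀ k))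
  set m := timeAverage τ f (n + 1)
  set y := bdiff2 τ x dx₀ (n + 1)
  have hfc : IntervalIntegrable f volume a b := intervalIntegrable_cell hτ hf hn hl hr
  have hf2c : IntervalIntegrable (fun s => ‖f s‖ ^ 2) volume a b :=
    intervalIntegrable_cell hτ hf2 hn hl hr
  have hμc : Continuous (timeWeight τ (n + 1)) := continuous_timeWeight _
  have hmf : IntervalIntegrable (fun s => m - f s) volume a b :=
    IntervalIntegrable.sub (by simp) hfc
  have hμy : Continuous fun s => timeWeight τ (n + 1) s • Pr (n + 1) y := by fun_prop
  have hmf2 : IntervalIntegrable (fun s => ‖m - f s‖ ^ 2) volume a b := by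
    refine IntervalIntegrable.mono_fun' (g := fun s => 2 * ‖m‖ ^ 2 + 2 * ‖f s‖ ^ 2)
      (IntervalIntegrable.add (by simp) (hf2c.const_mul 2)) ?_ ?_
    · exact hmf.def'.aestronglyMeasurable.norm.pow 2
    · refine Eventually.of_forall fun s => ?_
      beta_reduce
      rw [Real.norm_of_nonneg (by positivity)]
      have h1 := norm_sub_le m (f s)
      nlinarith [norm_nonneg (m - f s), sq_nonneg (‖m‖ - ‖f s‖)]
  have hDc := continuous_cubicReconDeriv (x := x) (dx₀ := dx₀) hτ
  have hec := continuous_evoFun (x := g) (dx₀ := dg₀) hτ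
  have i1 : IntervalIntegrable (fun t => ‖cubicReconDeriv x dx₀ τ t
      - Pr (n + 1) (cubicReconDeriv x dx₀ τ t)‖) volume a b :=
    Continuous.intervalIntegrable (by fun_prop) _ _
  have i2 : IntervalIntegrable (fun _ : ℝ => ‖S‖) volume a b := by simp
  have i3 : IntervalIntegrable (fun t => ‖evoFun τ g dg₀ t‖) volume a b :=
    Continuous.intervalIntegrable (by fun_prop) _ _
  have i4 : IntervalIntegrable (fun t => ‖∫ s in a..t, (m - f s)‖) volume a b :=
    (intervalIntegral.continuousOn_primitive_interval' hmf left_mem_uIcc).norm.intervalIntegrable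
  have i5 : IntervalIntegrable
      (fun t => ‖∫ s in a..t, timeWeight τ (n + 1) s • Pr (n + 1) y‖) volume a b :=
    (intervalIntegral.continuousOn_primitive_interval' (hμy.intervalIntegrable a b)
      left_mem_uIcc).norm.intervalIntegrable
  have hQ : IntervalIntegrable (fun t => ‖integratedResidual x dx₀ g dg₀ f τ t‖) volume a b := by
    refine ContinuousOn.intervalIntegrable ?_
    rw [uIcc_of_le hle]
    exact ((continuousOn_integratedResidual hτ hf).mono (cell_subset hτ hn)).norm
  have hmono := intervalIntegral.integral_mono_on hle hQ ((((i1.add i2).add i3).add i4).add i5)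
    (fun t ht => by
      rw [integratedResidual_eq hτ hf hg h0 hn ht]
      exact (norm_add_le _ _).trans (add_le_add_left ((norm_add_le _ _).trans
        (add_le_add_left ((norm_add_le _ _).trans (add_le_add_left (norm_add_le _ _) _)) _)) _))
  rw [intervalIntegral.integral_add (((i1.add i2).add i3).add i4) i5,
    intervalIntegral.integral_add ((i1.add i2).add i3) i4,
    intervalIntegral.integral_add (i1.add i2) i3, intervalIntegral.integral_add i1 i2,
    intervalIntegral.integral_const, hlen, smul_eq_mul] at hmono
  have b4 := integral_norm_primitive_le hle hmf hmf2 (integral_timeAverage_sub hτ hf hn)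
  have b5 := integral_norm_primitive_le hle (hμy.intervalIntegrable a b)
    (Continuous.intervalIntegrable (by fun_prop) _ _)
    (by rw [intervalIntegral.integral_smul_const, integral_timeWeight, zero_smul])
  rw [hlen] at b4 b5
  have b5' : √(∫ t in a..b, τ ^ 3 * ‖timeWeight τ (n + 1) t • Pr (n + 1) y‖ ^ 2)
      ≤ √(∫ t in a..b, τ ^ 3 * ‖timeWeight τ (n + 1) t • y‖ ^ 2) := by
    refine Real.sqrt_le_sqrt (intervalIntegral.integral_mono_on hle
      (Continuous.intervalIntegrable (by fun_prop) _ _)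
      (Continuous.intervalIntegrable (by fun_prop) _ _) fun t _ => ?_)
    rw [norm_smul, norm_smul]
    gcongr
    exact hPr _ _
  have b2 : τ * ‖S‖ ≤ τ * ∑ k ∈ Finset.range (n + 1),
      ‖Pr (k + 1) (bdiff τ x dx₀ k) - Pr k (bdiff τ x dx₀ k)‖ := by
    gcongr
    exact norm_sum_le _ _
  have b6 := mul_le_mul_of_nonneg_left b5' (by positivity : 0 ≤ 1 / Real.pi)
  linarith

/-- The bound of the integrated residual by the indicators. -/
theorem integral_norm_integratedResidual_le (hτ : 0 < τ)
    (hf : IntervalIntegrable f volume 0 (N * τ))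
    (hf2 : IntervalIntegrable (fun s => ‖f s‖ ^ 2) volume 0 (N * τ))
    (hPr : ∀ n v, ‖Pr n v‖ ≤ ‖v‖)
    (hg : ∀ n < N, g (n + 1) = timeAverage τ f (n + 1) - Pr (n + 1) (bdiff2 τ x dx₀ (n + 1)))
    (h0 : Pr 0 dx₀ = dx₀) :
    ∫ t in (0 : ℝ)..(N * τ), ‖integratedResidual x dx₀ g dg₀ f τ t‖
      ≤ ((∑ n ∈ Finset.Icc 1 N, ∫ t in (((n : ℝ) - 1) * τ)..(n * τ),
            ‖cubicReconDeriv x dx₀ τ t - Pr n (cubicReconDeriv x dx₀ τ t)‖)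
          + ∑ n ∈ Finset.range N, (N * τ - n * τ) *
              ‖Pr (n + 1) (bdiff τ x dx₀ n) - Pr n (bdiff τ x dx₀ n)‖)
        + zetaEvo τ N g dg₀ + 2 * (zetaOsc τ N f + zetaTRec τ N x dx₀) := by
  have hsplit : ∀ q : ℝ → ℝ, IntervalIntegrable q volume 0 (N * τ) →
      ∑ n ∈ Finset.range N, ∫ t in (n * τ)..((n + 1) * τ), q t = ∫ t in (0 : ℝ)..(N * τ), q t := by
    intro q hq
    have h := intervalIntegral.sum_integral_adjacent_intervals (μ := volume) (f := q) (n := N)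
      (a := fun n : ℕ => (n : ℝ) * τ) fun k hk => by
        have := intervalIntegrable_cell hτ hq hk (left_mem_Icc.2 (cell_le hτ k))
          (right_mem_Icc.2 (cell_le hτ k))
        simpa using this
    simpa using h
  have hQ : IntervalIntegrable (fun t => ‖integratedResidual x dx₀ g dg₀ f τ t‖) volume 0
      (N * τ) := by
    refine ContinuousOn.intervalIntegrable ?_
    rw [uIcc_of_le (by positivity)]
    exact (continuousOn_integratedResidual hτ hf).norm
  rw [← hsplit _ hQ]
  refine (Finset.sum_le_sum fun n hn => integral_norm_integratedResidual_cell_le hτ hf hf2 hPr hg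
    h0 (Finset.mem_range.1 hn)).trans (le_of_eq ?_)
  have hec := continuous_evoFun (x := g) (dx₀ := dg₀) hτ
  rw [Finset.sum_add_distrib, Finset.sum_add_distrib, Finset.sum_add_distrib,
    Finset.sum_add_distrib, sum_sum_range_succ, ← Finset.mul_sum, ← Finset.mul_sum,
    hsplit _ (hec.norm.intervalIntegrable _ _)]
  -- The indicators carry the factor `1 / (2π)`, the bound for primitives `1 / π`; hence the factor
  -- `2` in front of these two indicators.
  have hpi : 1 / Real.pi = 2 * (1 / (2 * Real.pi)) := by field_simp
  simp only [zetaEvo, zetaOsc, zetaTRec, sum_Icc_one_eq_sum_range, Nat.cast_add, Nat.cast_one,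
    add_sub_cancel_right]
  rw [hpi]
  ring

end ResidualBound

/-! ### The elasticity form on `H¹₀` -/

variable {d : ℕ} {Ω : Set (E d)}

/-- The bilinear form `(c ε(U)) : ε(V)` on second order tensors. -/
noncomputable def tensorForm (c : Ten4 d) : Ten d →L[ℝ] Ten d →L[ℝ] ℝ :=
  LinearMap.toContinuousBilinearMap <| LinearMap.mk₂ ℝ
    (fun U V => contract c (symPart fun i j => U (i, j)) (symPart fun i j => V (i, j)))
    (fun U U' V => by
      simp only [contract, symPart, PiLp.add_apply, ← Finset.sum_add_distrib]
      refine Finset.sum_congr rfl fun i _ => Finset.sum_congr rfl fun j _ =>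
        Finset.sum_congr rfl fun k _ => Finset.sum_congr rfl fun l _ => by ring)
    (fun a U V => by
      simp only [contract, symPart, PiLp.smul_apply, smul_eq_mul, Finset.mul_sum]
      refine Finset.sum_congr rfl fun i _ => Finset.sum_congr rfl fun j _ =>
        Finset.sum_congr rfl fun k _ => Finset.sum_congr rfl fun l _ => by ring)
    (fun U V V' => by
      simp only [contract, symPart, PiLp.add_apply, ← Finset.sum_add_distrib]
      refine Finset.sum_congr rfl fun i _ => Finset.sum_congr rfl fun j _ =>
        Finset.sum_congr rfl fun k _ => Finset.sum_congr rfl fun l _ => by ring)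
    (fun a U V => by
      simp only [contract, symPart, PiLp.smul_apply, smul_eq_mul, Finset.mul_sum]
      refine Finset.sum_congr rfl fun i _ => Finset.sum_congr rfl fun j _ =>
        Finset.sum_congr rfl fun k _ => Finset.sum_congr rfl fun l _ => by ring)

theorem tensorForm_apply (c : Ten4 d) (U V : Ten d) : tensorForm c U V
    = contract c (symPart fun i j => U (i, j)) (symPart fun i j => V (i, j)) := rfl

/-- The null Lagrangian `U : Vᵀ - tr U tr V`. -/
noncomputable def nullForm (d : ℕ) : Ten d →L[ℝ] Ten d →L[ℝ] ℝ :=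
  LinearMap.toContinuousBilinearMap <| LinearMap.mk₂ ℝ
    (fun U V => ∑ i, ∑ j, (U (i, j) * V (j, i) - U (i, i) * V (j, j)))
    (fun U U' V => by
      simp only [PiLp.add_apply, ← Finset.sum_add_distrib]
      refine Finset.sum_congr rfl fun i _ => Finset.sum_congr rfl fun j _ => by ring)
    (fun a U V => by
      simp only [PiLp.smul_apply, smul_eq_mul, Finset.mul_sum]
      refine Finset.sum_congr rfl fun i _ => Finset.sum_congr rfl fun j _ => by ring)
    (fun U V V' => by
      simp only [PiLp.add_apply, ← Finset.sum_add_distrib]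
      refine Finset.sum_congr rfl fun i _ => Finset.sum_congr rfl fun j _ => by ring)
    (fun a U V => by
      simp only [PiLp.smul_apply, smul_eq_mul, Finset.mul_sum]
      refine Finset.sum_congr rfl fun i _ => Finset.sum_congr rfl fun j _ => by ring)

theorem nullForm_apply (U V : Ten d) :
    nullForm d U V = ∑ i, ∑ j, (U (i, j) * V (j, i) - U (i, i) * V (j, j)) := rfl

/-- The square of the symmetric part is `(|U|² + U : Uᵀ) / 2`, so the two sides differ by `(tr U)² /
2`. -/
theorem half_norm_sq_add_nullForm_le (U : Ten d) :
    (‖U‖ ^ 2 + nullForm d U U) / 2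
      ≤ ∑ i, ∑ j, symPart (fun i j => U (i, j)) i j ^ 2 := by
  have h1 : ‖U‖ ^ 2 = ∑ i, ∑ j, U (i, j) ^ 2 := by
    rw [EuclideanSpace.real_norm_sq_eq, Fintype.sum_prod_type]
  have h2 : ∑ i, ∑ j, U (j, i) ^ 2 = ∑ i, ∑ j, U (i, j) ^ 2 := Finset.sum_comm
  have h3 : ∑ i, ∑ j, U (i, i) * U (j, j) = (∑ i, U (i, i)) ^ 2 := by
    rw [sq, Finset.sum_mul_sum]
  have h4 : ∑ i, ∑ j, symPart (fun i j => U (i, j)) i j ^ 2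
      = (1 / 4) * ∑ i, ∑ j, U (i, j) ^ 2 + (1 / 4) * ∑ i, ∑ j, U (j, i) ^ 2
        + (1 / 2) * ∑ i, ∑ j, U (i, j) * U (j, i) := by
    simp only [Finset.mul_sum, ← Finset.sum_add_distrib, symPart]
    refine Finset.sum_congr rfl fun i _ => Finset.sum_congr rfl fun j _ => by ring
  rw [nullForm_apply, h4, h2, h1]
  simp only [Finset.sum_sub_distrib]
  rw [h3]
  nlinarith [sq_nonneg (∑ i, U (i, i))]

/-- Up to the null set of the element boundaries the field is a finite sum of constants times
indicators, hence bounded. This supplies the boundedness of the stiffness tensor. -/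
theorem memLp_top_of_forall_eq {Y : Type*} [NormedAddCommGroup Y] {b : E d → Y} (𝒯 : Mesh Ω)
    (hb : ∀ K ∈ 𝒯.elements, ∀ x ∈ K, ∀ y ∈ K, b x = b y) : MemLp b ⊤ (volume.restrict Ω) := by
  have h1 : MemLp (fun x => ∑ K ∈ 𝒯.elements,
      K.indicator (fun _ => b (Classical.epsilon fun x => x ∈ K)) x) ⊤ (volume.restrict Ω) :=
    memLp_finsetSum _ fun K hK => (memLp_top_const _).indicator (𝒯.isOpen hK).measurableSet
  refine h1.ae_eq ?_
  filter_upwards [𝒯.ae_mem] with x hx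
  obtain ⟨K, hK, hxK⟩ := hx
  rw [Finset.sum_eq_single_of_mem K hK fun K' hK' hne => indicator_of_notMem
    (fun hx' => Set.disjoint_left.1 (𝒯.disjoint K' hK' K hK hne) hx' hxK) _,
    indicator_of_mem hxK,
    hb K hK _ (Classical.epsilon_spec (p := fun x => x ∈ K) ⟨x, hxK⟩) x hxK]

/-! ### Pairings of `L²` fields by a bounded field of bilinear forms. -/

section VariablePairing

variable {α F G : Type*} {m : MeasurableSpace α} {μ : Measure α} [NormedAddCommGroup F]
  [NormedSpace ℝ F] [NormedAddCommGroup G] [NormedSpace ℝ G] {b : α → F →L[ℝ] G →L[ℝ] ℝ}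

/-- The bilinear form `∫ b(x)(U(x), V(x))` for a bounded field `b` of bilinear forms. -/
noncomputable def variablePairing (hb : MemLp b ⊤ μ) : Lp F 2 μ →L[ℝ] Lp G 2 μ →L[ℝ] ℝ :=
  (ContinuousLinearMap.lpPairing (𝕜 := ℝ) (E := G →L[ℝ] ℝ) (F := G) (G := ℝ) μ 2 2
      (ContinuousLinearMap.id ℝ (G →L[ℝ] ℝ))).comp
    (ContinuousLinearMap.holderL (𝕜 := ℝ) (E := F →L[ℝ] G →L[ℝ] ℝ) (F := F) (G := G →L[ℝ] ℝ)
      μ ⊤ 2 2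
      (ContinuousLinearMap.id ℝ (F →L[ℝ] G →L[ℝ] ℝ)) (MemLp.toLp (E := F →L[ℝ] G →L[ℝ] ℝ) b hb))

theorem variablePairing_apply (hb : MemLp b ⊤ μ) (U : Lp F 2 μ) (V : Lp G 2 μ) :
    variablePairing hb U V = ∫ x, b x (U x) (V x) ∂μ := by
  rw [variablePairing, ContinuousLinearMap.comp_apply, ContinuousLinearMap.lpPairing_eq_integral,
    ContinuousLinearMap.holderL_apply_apply]
  refine integral_congr_ae ?_
  filter_upwards [ContinuousLinearMap.coeFn_holder (𝕜 := ℝ) (E := F →L[ℝ] G →L[ℝ] ℝ) (F := F)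
    (G := G →L[ℝ] ℝ) (r := 2) (ContinuousLinearMap.id ℝ (F →L[ℝ] G →L[ℝ] ℝ))
    (MemLp.toLp (E := F →L[ℝ] G →L[ℝ] ℝ) b hb) U,
    MemLp.coeFn_toLp (E := F →L[ℝ] G →L[ℝ] ℝ) hb] with x h1 h2
  rw [h1, h2]
  rfl

theorem integrable_variablePairing (hb : MemLp b ⊤ μ) (U : Lp F 2 μ) (V : Lp G 2 μ) :
    Integrable (fun x => b x (U x) (V x)) μ := by
  have h1 := ContinuousLinearMap.memLp_of_bilin (𝕜 := ℝ) (E := F →L[ℝ] G →L[ℝ] ℝ) (F := F)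
    (G := G →L[ℝ] ℝ) 2 (ContinuousLinearMap.id ℝ (F →L[ℝ] G →L[ℝ] ℝ)) hb (Lp.memLp U)
  exact memLp_one_iff_integrable.1
    (ContinuousLinearMap.memLp_of_bilin (𝕜 := ℝ) (E := G →L[ℝ] ℝ) (F := G) (G := ℝ) 1
      (ContinuousLinearMap.id ℝ (G →L[ℝ] ℝ)) h1 (Lp.memLp V))

end VariablePairing

/-- The elasticity form as a continuous bilinear form in the gradients. -/
noncomputable def elasticCLM {C : E d → Ten4 d}
    (hC : MemLp (fun x => tensorForm (C x)) ⊤ (volume.restrict Ω)) :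
    L2t Ω →L[ℝ] L2t Ω →L[ℝ] ℝ :=
  variablePairing hC

theorem elasticCLM_apply {C : E d → Ten4 d}
    (hC : MemLp (fun x => tensorForm (C x)) ⊤ (volume.restrict Ω)) (U V : L2t Ω) :
    elasticCLM hC U V = ∫ x in Ω, tensorForm (C x) (U x) (V x) :=
  variablePairing_apply hC U V

theorem elasticForm_eq {C : E d → Ten4 d}
    (hC : MemLp (fun x => tensorForm (C x)) ⊤ (volume.restrict Ω)) (u v : GradPair Ω) :
    elasticForm C u v = elasticCLM hC u.2 v.2 := by
  rw [elasticCLM_apply]; rfl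

theorem elasticCLM_comm (hΩ : IsOpen Ω) {C : E d → Ten4 d} {cstar : ℝ}
    (hCs : IsStiffness Ω C cstar)
    (hC : MemLp (fun x => tensorForm (C x)) ⊤ (volume.restrict Ω)) (U V : L2t Ω) :
    elasticCLM hC U V = elasticCLM hC V U := by
  rw [elasticCLM_apply, elasticCLM_apply]
  refine setIntegral_congr_fun hΩ.measurableSet fun x hx => ?_
  simp only [tensorForm_apply, contract]
  -- The index pairs `(i, j)` and `(k, l)` are interchanged as a whole, which prepares for the major
  -- symmetry of `C`.
  have : ∀ A B : Fin d → Fin d → ℝ, ∑ i, ∑ j, ∑ k, ∑ l, C x i j k l * A k l * B i j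
      = ∑ k, ∑ l, ∑ i, ∑ j, C x i j k l * A k l * B i j := fun A B => by
    calc _ = ∑ p : Fin d × Fin d, ∑ q : Fin d × Fin d,
          C x p.1 p.2 q.1 q.2 * A q.1 q.2 * B p.1 p.2 := by
          simp only [Fintype.sum_prod_type]
      _ = ∑ q : Fin d × Fin d, ∑ p : Fin d × Fin d,
          C x p.1 p.2 q.1 q.2 * A q.1 q.2 * B p.1 p.2 := Finset.sum_comm
      _ = _ := by simp only [Fintype.sum_prod_type]
  rw [this]
  refine Finset.sum_congr rfl fun i _ => Finset.sum_congr rfl fun j _ =>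
        Finset.sum_congr rfl fun k _ => Finset.sum_congr rfl fun l _ => ?_
  rw [hCs.symm_major x hx k l i j]
  ring

/-! ### Korn's inequality -/

/-- Both sides equal `-∫ f ∂ᵥ∂_w g`, by integration by parts and the symmetry of second derivatives.
Compact support of `f` alone removes the boundary terms. -/
theorem integral_fderiv_mul_fderiv_comm {f g : E d → ℝ} (hf : ContDiff ℝ ∞ f)
    (hg : ContDiff ℝ ∞ g) (hfc : HasCompactSupport f) (v w : E d) :
    ∫ x, fderiv ℝ f x v * fderiv ℝ g x w = ∫ x, fderiv ℝ f x w * fderiv ℝ g x v := by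
  have hg' : ∀ w, ContDiff ℝ ∞ fun x => fderiv ℝ g x w := fun w =>
    (hg.fderiv_right (m := ∞) le_rfl).clm_apply contDiff_const
  have hf' : ∀ w, Continuous fun x => fderiv ℝ f x w := fun w =>
    ((hf.fderiv_right (m := ∞) le_rfl).clm_apply contDiff_const).continuous
  have hg'' : ∀ v w, Continuous fun x => fderiv ℝ (fun x => fderiv ℝ g x w) x v := fun v w =>
    (((hg' w).fderiv_right (m := ∞) le_rfl).clm_apply contDiff_const).continuous
  have key : ∀ v w, ∫ x, f x * fderiv ℝ (fun x => fderiv ℝ g x w) x v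
      = - ∫ x, fderiv ℝ f x v * fderiv ℝ g x w := fun v w => by
    refine integral_mul_fderiv_eq_neg_fderiv_mul_of_integrable ?_ ?_ ?_ ?_ ?_
    · exact ((hf' v).mul (hg' w).continuous).integrable_of_hasCompactSupport
        ((hfc.fderiv_apply ℝ v).mul_right)
    · exact (hf.continuous.mul (hg'' v w)).integrable_of_hasCompactSupport hfc.mul_right
    · exact (hf.continuous.mul (hg' w).continuous).integrable_of_hasCompactSupport hfc.mul_right
    · exact fun x _ => (hf.differentiable (by simp)).differentiableAt
    · exact fun x _ => ((hg' w).differentiable (by simp)).differentiableAt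
  have hsymm : ∀ x, fderiv ℝ (fun x => fderiv ℝ g x w) x v
      = fderiv ℝ (fun x => fderiv ℝ g x v) x w := fun x => by
    have hd : DifferentiableAt ℝ (fderiv ℝ g) x :=
      ((hg.fderiv_right (m := ∞) le_rfl).differentiable (by simp)).differentiableAt
    have h1 : ∀ v w : E d, fderiv ℝ (fun x => fderiv ℝ g x w) x v
        = fderiv ℝ (fderiv ℝ g) x v w := fun v w => by
      rw [fderiv_clm_apply hd (by fun_prop)]
      simp
    rw [h1, h1]
    exact (hg.contDiffAt.isSymmSndFDerivAt (by
      simp only [minSmoothness_of_isRCLikeNormedField]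
      exact WithTop.coe_le_coe.2 le_top)) v w
  have h1 := key v w
  simp only [hsymm] at h1
  rw [key w v] at h1
  linarith

/-- The pairing of gradients by the null Lagrangian. -/
noncomputable def nullCLM (Ω : Set (E d)) : L2t Ω →L[ℝ] L2t Ω →L[ℝ] ℝ :=
  (nullForm d).lpPairing (volume.restrict Ω) 2 2

theorem nullCLM_apply (U V : L2t Ω) : nullCLM Ω U V = ∫ x in Ω, nullForm d (U x) (V x) :=
  ContinuousLinearMap.lpPairing_eq_integral _ _ _

/-- Each index pair `(i, j)` contributes zero by itself: exchanging the two directions of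
differentiation turns the first product into the second under the integral. -/
theorem nullCLM_testPairs {p q : GradPair Ω} (hp : p ∈ testPairs Ω) (hq : q ∈ testPairs Ω) :
    nullCLM Ω p.2 q.2 = 0 := by
  obtain ⟨φ, hφ, hφc, hφΩ, -, hp2⟩ := hp
  obtain ⟨ψ, hψ, hψc, -, -, hq2⟩ := hq
  have hφi : ∀ i, ContDiff ℝ ∞ fun x => φ x i := fun i => (contDiff_euclidean.1 hφ) i
  have hψi : ∀ i, ContDiff ℝ ∞ fun x => ψ x i := fun i => (contDiff_euclidean.1 hψ) i
  have hφic : ∀ i, HasCompactSupport fun x => φ x i := fun i =>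
    hφc.comp_left (g := fun y : E d => y i) (by simp)
  have hcomp : ∀ (χ : E d → E d), ContDiff ℝ ∞ χ → ∀ x v i,
      (fderiv ℝ χ x v) i = fderiv ℝ (fun x => χ x i) x v := fun χ hχ x v i => by
    have h1 : HasFDerivAt χ (fderiv ℝ χ x) x :=
      (hχ.differentiable (by simp)).differentiableAt.hasFDerivAt
    have h2 := (EuclideanSpace.proj i : E d →L[ℝ] ℝ).hasFDerivAt.comp x h1
    have h3 : HasFDerivAt (fun x => χ x i) _ x := h2
    rw [h3.fderiv]
    rfl
  have h1 : nullCLM Ω p.2 q.2 = ∫ x, ∑ i, ∑ j,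
      (fderiv ℝ (fun x => φ x i) x (EuclideanSpace.single j 1)
          * fderiv ℝ (fun x => ψ x j) x (EuclideanSpace.single i 1)
        - fderiv ℝ (fun x => φ x i) x (EuclideanSpace.single i 1)
          * fderiv ℝ (fun x => ψ x j) x (EuclideanSpace.single j 1)) := by
    -- The integral over `Ω` extends to the whole space because `φ`, and with it its gradient,
    -- vanishes outside `Ω`.
    refine Eq.trans ?_ (setIntegral_eq_integral_of_forall_compl_eq_zero (s := Ω) ?_)
    · rw [nullCLM_apply]
      refine integral_congr_ae ?_
      filter_upwards [hp2, hq2] with x h1 h2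
      rw [h1, h2, nullForm_apply]
      simp only [hcomp φ hφ, hcomp ψ hψ]
    · intro x hx
      have hx0 : fderiv ℝ φ x = 0 := by
        refine image_eq_zero_of_notMem_tsupport fun h => hx (hφΩ (tsupport_fderiv_subset ℝ h))
      refine Finset.sum_eq_zero fun i _ => Finset.sum_eq_zero fun j _ => ?_
      rw [← hcomp φ hφ, ← hcomp φ hφ, hx0]
      simp
  have hint : ∀ i j v w, Integrable (fun x => fderiv ℝ (fun x => φ x i) x v
      * fderiv ℝ (fun x => ψ x j) x w) := fun i j v w => by
    refine Continuous.integrable_of_hasCompactSupport ?_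
      (((hφic i).fderiv_apply ℝ v).mul_right)
    exact (((hφi i).fderiv_right (m := ∞) le_rfl).clm_apply contDiff_const).continuous.mul
      (((hψi j).fderiv_right (m := ∞) le_rfl).clm_apply contDiff_const).continuous
  rw [h1, integral_finsetSum]
  swap
  · exact fun i _ => integrable_finsetSum _ fun j _ => (hint i j _ _).sub (hint i j _ _)
  refine Finset.sum_eq_zero fun i _ => ?_
  rw [integral_finsetSum]
  swap
  · exact fun j _ => (hint i j _ _).sub (hint i j _ _)
  refine Finset.sum_eq_zero fun j _ => ?_
  rw [integral_sub (hint i j _ _) (hint i j _ _),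
    integral_fderiv_mul_fderiv_comm (hφi i) (hψi j) (hφic i), sub_self]

theorem H10_le_of_testPairs_subset {W : Submodule ℝ (GradPair Ω)}
    (hW : IsClosed (W : Set (GradPair Ω))) (h : testPairs Ω ⊆ W) : H10 Ω ≤ W :=
  Submodule.topologicalClosure_minimal _ (Submodule.span_le.2 h) hW

theorem isClosed_H10 : IsClosed (H10 Ω : Set (GradPair Ω)) :=
  Submodule.isClosed_topologicalClosure _

theorem testPairs_subset_H10 : testPairs Ω ⊆ H10 Ω :=
  Submodule.subset_span.trans (Submodule.le_topologicalClosure _)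

/-- Density of the test pairs, used in one argument at a time: the kernel of a continuous functional
is a closed subspace. -/
theorem nullCLM_H10 {p q : GradPair Ω} (hp : p ∈ H10 Ω) (hq : q ∈ H10 Ω) :
    nullCLM Ω p.2 q.2 = 0 := by
  have h1 : ∀ q ∈ testPairs Ω, ∀ p ∈ H10 Ω, nullCLM Ω p.2 q.2 = 0 := fun q hq p hp => by
    let L : GradPair Ω →L[ℝ] ℝ := ((nullCLM Ω).flip q.2).comp (.snd ℝ (L2v Ω) (L2t Ω))
    exact H10_le_of_testPairs_subset (W := LinearMap.ker L.toLinearMap) L.isClosed_ker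
      (fun p hp => nullCLM_testPairs hp hq) hp
  let L : GradPair Ω →L[ℝ] ℝ := (nullCLM Ω p.2).comp (.snd ℝ (L2v Ω) (L2t Ω))
  exact H10_le_of_testPairs_subset (W := LinearMap.ker L.toLinearMap) L.isClosed_ker
    (fun q hq => h1 q hq p hp) hq

/-- Coercivity of the elasticity form on `H¹₀`. -/
theorem elasticCLM_coercive (hΩ : IsOpen Ω) {C : E d → Ten4 d} {cstar : ℝ}
    (hCs : IsStiffness Ω C cstar)
    (hC : MemLp (fun x => tensorForm (C x)) ⊤ (volume.restrict Ω)) {v : GradPair Ω}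
    (hv : v ∈ H10 Ω) : cstar / 2 * ‖v.2‖ ^ 2 ≤ elasticCLM hC v.2 v.2 := by
  have hn := nullCLM_H10 hv hv
  rw [nullCLM_apply] at hn
  have hi1 : Integrable (fun x => nullForm d (v.2 x) (v.2 x)) (volume.restrict Ω) :=
    memLp_one_iff_integrable.1 ((nullForm d).memLp_of_bilin 1 (Lp.memLp v.2) (Lp.memLp v.2))
  have hi2 : Integrable (fun x => ‖v.2 x‖ ^ 2) (volume.restrict Ω) :=
    (memLp_two_iff_integrable_sq_norm (Lp.memLp v.2).1).1 (Lp.memLp v.2)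
  have hnorm : ‖v.2‖ ^ 2 = ∫ x in Ω, ‖v.2 x‖ ^ 2 := by
    rw [← real_inner_self_eq_norm_sq, L2.inner_def]
    simp only [real_inner_self_eq_norm_sq]
  calc cstar / 2 * ‖v.2‖ ^ 2
      = ∫ x in Ω, cstar / 2 * (‖v.2 x‖ ^ 2 + nullForm d (v.2 x) (v.2 x)) := by
        rw [integral_const_mul, integral_add hi2 hi1, hn, hnorm, add_zero]
    _ ≤ ∫ x in Ω, tensorForm (C x) (v.2 x) (v.2 x) := by
        refine setIntegral_mono_on ((hi2.add hi1).const_mul _) (integrable_variablePairing hC _ _)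
          hΩ.measurableSet fun x hx => ?_
        have h1 := hCs.coercive x hx (symPart fun i j => v.2 x (i, j)) fun i j => by
          simp only [symPart]; ring
        have h2 := mul_le_mul_of_nonneg_left (half_norm_sq_add_nullForm_le (v.2 x)) hCs.pos.le
        rw [tensorForm_apply]
        linarith
    _ = _ := (elasticCLM_apply hC _ _).symm

/-! ### The sign of the Poincaré constant -/

/-- The test pair of a smooth field with compact support in `Ω`. -/
theorem exists_mem_H10_ae_eq {φ : E d → E d} (hφ : ContDiff ℝ ∞ φ) (hφc : HasCompactSupport φ)
    (hφΩ : tsupport φ ⊆ Ω) : ∃ p ∈ H10 Ω, p.1 =ᵐ[volume.restrict Ω] φ := by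
  set D : E d → Ten d := fun x =>
      WithLp.toLp 2 fun ij : Fin d × Fin d => (fderiv ℝ φ x (EuclideanSpace.single ij.2 1)) ij.1
    with hD
  have hDc : Continuous D := by
    refine (PiLp.continuous_toLp 2 _).comp (continuous_pi fun ij => ?_)
    exact (EuclideanSpace.proj ij.1 : E d →L[ℝ] ℝ).continuous.comp
      (((hφ.fderiv_right (m := ∞) le_rfl).clm_apply contDiff_const).continuous)
  have hDs : HasCompactSupport D := by
    refine (hφc.fderiv ℝ).mono' fun x hx => ?_
    by_contra hn
    refine hx ?_
    have : fderiv ℝ φ x = 0 := image_eq_zero_of_notMem_tsupport hn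
    simp only [hD, this]
    ext ij
    simp
  have h1 : MemLp φ 2 (volume.restrict Ω) :=
    (hφ.continuous.memLp_of_hasCompactSupport hφc (p := 2) (μ := volume)).restrict Ω
  have h2 : MemLp D 2 (volume.restrict Ω) :=
    (hDc.memLp_of_hasCompactSupport hDs (p := 2) (μ := volume)).restrict Ω
  exact ⟨(h1.toLp, h2.toLp), testPairs_subset_H10
    ⟨φ, hφ, hφc, hφΩ, h1.coeFn_toLp, h2.coeFn_toLp⟩, h1.coeFn_toLp⟩

/-- A bump function around `x₀` times a coordinate vector. It serves to exclude negative Poincaré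
constants. -/
theorem exists_mem_H10_ne_zero (hΩ : IsOpen Ω) {x₀ : E d} (hx₀ : x₀ ∈ Ω) (i : Fin d) :
    ∃ p ∈ H10 Ω, p.1 ≠ 0 := by
  obtain ⟨ε, hε, hball⟩ := Metric.isOpen_iff.1 hΩ x₀ hx₀
  let b : ContDiffBump x₀ := ⟨ε / 4, ε / 2, by positivity, by linarith⟩
  set φ : E d → E d := fun x => b x • EuclideanSpace.single i (1 : ℝ) with hφ
  have hts : tsupport φ ⊆ tsupport b := tsupport_smul_subset_left _ _
  have hc : HasCompactSupport φ := b.hasCompactSupport.smul_right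
  have hsm : ContDiff ℝ ∞ φ := b.contDiff.smul contDiff_const
  obtain ⟨p, hp, hpφ⟩ := exists_mem_H10_ae_eq (Ω := Ω) hsm hc (hts.trans (by
    rw [b.tsupport_eq]
    refine (Metric.closedBall_subset_ball ?_).trans hball
    change ε / 2 < ε
    linarith))
  refine ⟨p, hp, fun h0 => ?_⟩
  rw [h0] at hpφ
  have h1 : φ =ᵐ[volume.restrict Ω] fun _ => (0 : E d) :=
    hpφ.symm.trans (Lp.coeFn_zero _ _ _)
  have h2 := Measure.eqOn_open_of_ae_eq h1 hΩ hsm.continuous.continuousOn continuousOn_const hx₀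
  have h3 : b x₀ = 1 := b.one_of_mem_closedBall (Metric.mem_closedBall_self b.rIn_pos.le)
  have h4 := congrArg (fun y : E d => y i) h2
  simp [hφ, h3] at h4

/-- A negative Poincaré constant is possible only if `L²(Ω)^d` is trivial. -/
theorem poincare_mul_norm_nonneg (hΩ : IsOpen Ω) {CF : ℝ}
    (hCF : ∀ v ∈ H10 Ω, ‖v.1‖ ≤ CF * ‖v.2‖) (g : L2v Ω) : 0 ≤ CF * ‖g‖ := by
  rcases le_or_gt 0 CF with h | h
  · positivity
  · have hg : g = 0 := by
      apply Lp.ext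
      -- For `Ω = ∅` and for `d = 0` the space `L²(Ω)^d` is trivial. Otherwise a negative constant
      -- would force every `H¹₀` field to vanish.
      rcases Ω.eq_empty_or_nonempty with rfl | ⟨x₀, hx₀⟩
      · exact (ae_restrict_iff' MeasurableSet.empty).2 (Eventually.of_forall fun x hx => hx.elim)
      · cases d with
        | zero => exact Eventually.of_forall fun x => Subsingleton.elim _ _
        | succ n =>
          obtain ⟨p, hp, hp0⟩ := exists_mem_H10_ne_zero hΩ hx₀ 0
          refine absurd (norm_le_zero_iff.1 ((hCF p hp).trans ?_)) hp0
          exact mul_nonpos_of_nonpos_of_nonneg h.le (norm_nonneg _)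
    rw [hg, norm_zero, mul_zero]

/-! ### Properties of the discrete scheme -/

theorem norm_proj_le (𝒯 : Mesh Ω) (r : ℕ) (v : L2v Ω) : ‖proj 𝒯 r v‖ ≤ ‖v‖ :=
  (dgSpace 𝒯 r).norm_starProjection_apply_le v

/-- If `a_h(z, ·)` is represented on `V_h` by `h`, then `B z = Π_h h`. -/
theorem discreteOp_eq_proj (𝒯 : Mesh Ω) (r : ℕ) (C : E d → Ten4 d) (α : ℝ) {z h : L2v Ω}
    (hz : ∀ v ∈ dgSpace 𝒯 r, dgForm 𝒯 C α z v = ⟪h, v⟫_ℝ) :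
    discreteOp 𝒯 r C α z = proj 𝒯 r h := by
  -- The representation `hz` also supplies the linearity of `a_h(z, ·)` on `V_h` that the Riesz
  -- representative requires.
  obtain ⟨h1, h2⟩ := rieszRep_spec (dgSpace 𝒯 r) (dgForm 𝒯 C α z)
    ((innerSL ℝ h).toLinearMap.comp (dgSpace 𝒯 r).subtype) (fun v => hz v v.2)
  refine (Submodule.eq_starProjection_of_mem_of_inner_eq_zero h1 fun v hv => ?_).symm
  have h3 := h2 ⟨v, hv⟩
  rw [inner_sub_left, sub_eq_zero, h3, hz v hv]

/-- The scheme states that `f(tⁿ) - ∂²u_hⁿ` represents `a_h(u_hⁿ, ·)` on `V_hⁿ`. Hence `Bⁿu_hⁿ` is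
its projection, and `Πⁿf(tⁿ)` cancels in `gⁿ`. -/
theorem reconData_succ {𝒯 : ℕ → Mesh Ω} {r : ℕ} {C : E d → Ten4 d} {α τ : ℝ} {N : ℕ}
    {f : ℝ → L2v Ω} {u₀ u₁ : L2v Ω} {uh : ℕ → L2v Ω} {duh₀ : L2v Ω}
    (huh : IsDiscreteSolution 𝒯 r C α τ N f u₀ u₁ uh duh₀) {n : ℕ} (hn : n < N) :
    reconData 𝒯 r C α τ f uh (n + 1) = timeAverage τ f (n + 1)
      - (dgSpace (𝒯 (n + 1)) r).starProjection (bdiff2 τ uh duh₀ (n + 1)) := by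
  have h := discreteOp_eq_proj (𝒯 (n + 1)) r C α (z := uh (n + 1))
    (h := f ((n + 1 : ℕ) * τ) - bdiff2 τ uh duh₀ (n + 1)) fun v hv => by
      have := huh.step (n + 1) (by omega) hn v hv
      rw [inner_sub_left, ← this]
      ring
  rw [reconData, h, proj, proj, map_sub]
  abel

/-- At each time the reconstruction is a linear combination of nodal values and of `∂x⁰`. For `t ≤ N
τ` no node beyond `N` is involved; `1 ≤ N` is needed because the first piece uses `x¹`. -/
theorem cubicRecon_mem {X : Type*} [NormedAddCommGroup X] [NormedSpace ℝ X] (S : Submodule ℝ X)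
    {τ : ℝ} {N : ℕ} {x : ℕ → X} {dx₀ : X} (hτ : 0 < τ) (hN : 1 ≤ N) (hx : ∀ n ≤ N, x n ∈ S)
    (hdx : dx₀ ∈ S) {t : ℝ} (ht : t ≤ N * τ) : cubicRecon τ x dx₀ t ∈ S := by
  have hn : stepIdx τ t ≤ N := by
    refine max_le hN (Nat.ceil_le.2 ?_)
    rwa [div_le_iff₀ hτ]
  have hb : ∀ n ≤ N, bdiff τ x dx₀ n ∈ S := by
    intro n hn
    cases n with
    | zero => exact hdx
    | succ m => exact S.smul_mem _ (S.sub_mem (hx _ hn) (hx _ (by omega)))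
  exact S.sub_mem (S.add_mem (S.smul_mem _ (hx _ hn)) (S.smul_mem _ (hx _ (by omega))))
    (S.smul_mem _ (S.smul_mem _ (S.sub_mem (hb _ hn) (hb _ (by omega)))))

/-- The reconstruction in time preserves the stationary problem. -/
theorem cubicRecon_solvesSE {C : E d → Ten4 d}
    (hC : MemLp (fun x => tensorForm (C x)) ⊤ (volume.restrict Ω))
    {τ : ℝ} {N : ℕ} (hτ : 0 < τ) (hN : 1 ≤ N) {g : ℕ → L2v Ω} {dg₀ : L2v Ω}
    {w : ℕ → GradPair Ω} {dw₀ : GradPair Ω} (hw : ∀ n ≤ N, SolvesSE C (g n) (w n))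
    (hdw₀ : SolvesSE C dg₀ dw₀) {t : ℝ} (ht : t ≤ N * τ) :
    SolvesSE C (cubicRecon τ g dg₀ t) (cubicRecon τ w dw₀ t) := by
  -- The pairs of a solution and its datum form a subspace. Reconstructing the sequence of pairs
  -- stays in it, and the two coordinates are the separate reconstructions.
  let S : Submodule ℝ (GradPair Ω × L2v Ω) :=
    { carrier := {p | SolvesSE C p.2 p.1}
      add_mem' := fun {p q} hp hq => ⟨Submodule.add_mem _ hp.1 hq.1, fun v hv => by
        have h1 := hp.2 v hv
        have h2 := hq.2 v hv
        rw [elasticForm_eq hC] at h1 h2 ⊢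
        rw [Prod.fst_add, Prod.snd_add, Prod.snd_add, map_add, _root_.add_apply,
          h1, h2, inner_add_left]⟩
      zero_mem' := ⟨Submodule.zero_mem _, fun v hv => by
        rw [elasticForm_eq hC]
        simp⟩
      smul_mem' := fun c p hp => ⟨Submodule.smul_mem _ _ hp.1, fun v hv => by
        have h1 := hp.2 v hv
        rw [elasticForm_eq hC] at h1 ⊢
        rw [Prod.smul_fst, Prod.smul_snd, Prod.smul_snd, map_smul, _root_.smul_apply,
          h1, real_inner_smul_left, smul_eq_mul]⟩ }
  have h : cubicRecon τ (fun n => (w n, g n)) (dw₀, dg₀) t ∈ S := cubicRecon_mem S hτ hN hw hdw₀ ht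
  have h1 := map_cubicRecon (τ := τ) (x := fun n => (w n, g n)) (dx₀ := (dw₀, dg₀))
    (LinearMap.fst ℝ (GradPair Ω) (L2v Ω)) t
  have h2 := map_cubicRecon (τ := τ) (x := fun n => (w n, g n)) (dx₀ := (dw₀, dg₀))
    (LinearMap.snd ℝ (GradPair Ω) (L2v Ω)) t
  simp only [LinearMap.fst_apply, LinearMap.snd_apply] at h1 h2
  rw [← h1, ← h2]
  exact h

theorem intervalIntegrable_of_memLp_two {X : Type*} [NormedAddCommGroup X] {q : ℝ → X} {T : ℝ}
    (hT : 0 ≤ T) (hq : MemLp q 2 (volume.restrict (Ioo 0 T))) :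
    IntervalIntegrable q volume 0 T := by
  rw [intervalIntegrable_iff_integrableOn_Ioo_of_le hT]
  exact hq.integrable (by norm_num)

theorem intervalIntegrable_norm_sq_of_memLp_two {X : Type*} [NormedAddCommGroup X] {q : ℝ → X}
    {T : ℝ} (hT : 0 ≤ T) (hq : MemLp q 2 (volume.restrict (Ioo 0 T))) :
    IntervalIntegrable (fun t => ‖q t‖ ^ 2) volume 0 T := by
  rw [intervalIntegrable_iff_integrableOn_Ioo_of_le hT]
  exact (memLp_two_iff_integrable_sq_norm hq.1).1 hq

/-! ### The error bound -/

/-- Separability is what allows one null set of times for all test functions in `energy_bound`. -/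
instance secondCountableTopology_L2 {F : Type*} [NormedAddCommGroup F]
    [TopologicalSpace.SeparableSpace F] :
    SecondCountableTopology (Lp F 2 (volume.restrict Ω)) :=
  have : Fact ((2 : ENNReal) ≠ ⊤) := ⟨by norm_num⟩
  Lp.SecondCountableTopology

/-- The weak form of the error equation, integrated in time. -/
theorem error_equation {C : E d → Ten4 d}
    (hC : MemLp (fun x => tensorForm (C x)) ⊤ (volume.restrict Ω)) {T : ℝ} (hT : 0 ≤ T)
    {f : ℝ → L2v Ω} (hf : IntervalIntegrable f volume 0 T) {u₁ : L2v Ω} {u : ℝ → GradPair Ω}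
    (hu : IntervalIntegrable u volume 0 T) {u' D : ℝ → L2v Ω} {wN : ℝ → GradPair Ω}
    (hwN : Continuous wN) {gN : ℝ → L2v Ω} (hgN : Continuous gN)
    (hw : ∀ t ∈ Icc 0 T, SolvesSE C (gN t) (wN t)) {φ : GradPair Ω} (hφ : φ ∈ H10 Ω)
    (hweak : ∀ᵐ t ∂volume.restrict (Ioo 0 T),
      ⟪u' t, φ.1⟫_ℝ = ⟪u₁, φ.1⟫_ℝ + ∫ s in (0 : ℝ)..t, (⟪f s, φ.1⟫_ℝ - elasticForm C (u s) φ)) :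
    ∀ᵐ t ∂volume.restrict (Ioo 0 T),
      ⟪D t - u' t, φ.1⟫_ℝ + elasticCLM hC (∫ s in (0 : ℝ)..t, (wN s - u s).2) φ.2
        = ⟪D t - u₁ + (∫ s in (0 : ℝ)..t, gN s) - ∫ s in (0 : ℝ)..t, f s, φ.1⟫_ℝ := by
  filter_upwards [hweak, ae_restrict_mem measurableSet_Ioo] with t ht htm
  have hsub : uIcc 0 t ⊆ uIcc 0 T := by
    rw [uIcc_of_le hT, uIcc_of_le htm.1.le]; exact Icc_subset_Icc_right htm.2.le
  have hft := hf.mono_set hsub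
  have hut := hu.mono_set hsub
  let L1 : L2v Ω →L[ℝ] ℝ := innerSL ℝ φ.1
  let L2 : L2t Ω →L[ℝ] ℝ := (elasticCLM hC).flip φ.2
  have hL1 : ∀ x, L1 x = ⟪x, φ.1⟫_ℝ := fun x =>
    show ⟪φ.1, x⟫_ℝ = ⟪x, φ.1⟫_ℝ from real_inner_comm _ _
  have hL2 : ∀ x, L2 x = elasticCLM hC x φ.2 := fun x => rfl
  have hu2 := intervalIntegrable_snd hut
  have hw2 : IntervalIntegrable (fun s => (wN s).2) volume 0 t :=
    hwN.snd.intervalIntegrable _ _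
  have i1 : ∫ s in (0 : ℝ)..t, ⟪f s, φ.1⟫_ℝ = ⟪∫ s in (0 : ℝ)..t, f s, φ.1⟫_ℝ := by
    rw [← hL1, ← L1.intervalIntegral_comp_comm hft]
    simp only [hL1]
  have i2 : ∫ s in (0 : ℝ)..t, ⟪gN s, φ.1⟫_ℝ = ⟪∫ s in (0 : ℝ)..t, gN s, φ.1⟫_ℝ := by
    rw [← hL1, ← L1.intervalIntegral_comp_comm (hgN.intervalIntegrable _ _)]
    simp only [hL1]
  have i3 : ∫ s in (0 : ℝ)..t, elasticForm C (u s) φ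
      = elasticCLM hC (∫ s in (0 : ℝ)..t, (u s).2) φ.2 := by
    rw [← hL2, ← L2.intervalIntegral_comp_comm hu2]
    simp only [hL2, elasticForm_eq hC]
  -- The stationary problems hold at every time, so the elastic term of `w_N` becomes the computable
  -- datum `g_N`.
  have i4 : elasticCLM hC (∫ s in (0 : ℝ)..t, (wN s).2) φ.2
      = ∫ s in (0 : ℝ)..t, ⟪gN s, φ.1⟫_ℝ := by
    rw [← hL2, ← L2.intervalIntegral_comp_comm hw2]
    refine intervalIntegral.integral_congr fun s hs => ?_
    have hs' := hsub hs
    rw [uIcc_of_le hT] at hs'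
    have := (hw s hs').2 φ hφ
    rw [elasticForm_eq hC] at this
    rw [hL2, this]
  have j1 : IntervalIntegrable (fun s => ⟪f s, φ.1⟫_ℝ) volume 0 t := by
    simp only [← hL1]
    exact ⟨L1.integrable_comp hft.1, L1.integrable_comp hft.2⟩
  have j2 : IntervalIntegrable (fun s => elasticForm C (u s) φ) volume 0 t := by
    simp only [elasticForm_eq hC]
    exact ⟨L2.integrable_comp hu2.1, L2.integrable_comp hu2.2⟩
  rw [intervalIntegral.integral_sub j1 j2, i1, i3] at ht
  simp only [Prod.snd_sub]
  rw [intervalIntegral.integral_sub hw2 hu2, map_sub, _root_.sub_apply, i4, i2, inner_sub_left,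
    ht, inner_sub_left, inner_add_left, inner_sub_left]
  ring

/-- The bound of the reconstruction error by the integrated residual. -/
theorem norm_recon_sub_le_residual (hΩ : IsOpen Ω)
    {C : E d → Ten4 d} {cstar : ℝ} (hC : IsStiffness Ω C cstar)
    {CF : ℝ} (hCF : ∀ v ∈ H10 Ω, ‖v.1‖ ≤ CF * ‖v.2‖)
    {N : ℕ} (hN : 1 ≤ N) {τ : ℝ} (hτ : 0 < τ)
    {f : ℝ → L2v Ω} (hf : MemLp f 2 (volume.restrict (Ioo 0 (N * τ))))
    {u₀ : GradPair Ω} {u₁ : L2v Ω}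
    {u : ℝ → GradPair Ω} (hu : IsWeakSolution C (N * τ) f u₀ u₁ u)
    {𝒯 : ℕ → Mesh Ω} {r : ℕ} {α : ℝ}
    (hCT : ∀ n ≤ N, ∀ K ∈ (𝒯 n).elements, ∀ x ∈ K, ∀ y ∈ K, C x = C y)
    {uh : ℕ → L2v Ω} {duh₀ : L2v Ω}
    {w : ℕ → GradPair Ω} (hw : ∀ n ≤ N, SolvesSE C (reconData 𝒯 r C α τ f uh n) (w n))
    {dw₀ : GradPair Ω} (hdw₀ : SolvesSE C (reconData₀ 𝒯 r C α f duh₀) dw₀) :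
    ∀ t ∈ Icc 0 (N * τ), ‖(cubicRecon τ w dw₀ t - u t).1‖ ≤
      ‖(w 0).1 - u₀.1‖ + √2 * (CF * ‖duh₀ - u₁‖) * (√cstar)⁻¹
        + ∫ s in (0 : ℝ)..t, ‖integratedResidual uh duh₀ (reconData 𝒯 r C α τ f uh)
            (reconData₀ 𝒯 r C α f duh₀) f τ s
          + ((cubicReconDeriv w dw₀ τ s).1 - cubicReconDeriv uh duh₀ τ s)‖ := by
  have hT : (0 : ℝ) ≤ N * τ := by positivity
  obtain ⟨u', hu', hu1, huw⟩ := hu.weak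
  -- A single mesh suffices for the boundedness of `C`; the initial one is taken.
  have hCm : MemLp (fun x => tensorForm (C x)) ⊤ (volume.restrict Ω) :=
    memLp_top_of_forall_eq (Y := Ten d →L[ℝ] Ten d →L[ℝ] ℝ) (𝒯 0) fun K hK x hx y hy =>
      congrArg tensorForm (hCT 0 (Nat.zero_le _) K hK x hx y hy)
  set g := reconData 𝒯 r C α τ f uh
  set dg₀ := reconData₀ 𝒯 r C α f duh₀
  set D := cubicReconDeriv uh duh₀ τ with hD
  set Dw := cubicReconDeriv w dw₀ τ with hDw
  have hDc : Continuous D := continuous_cubicReconDeriv hτ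
  have hDwc : Continuous Dw := continuous_cubicReconDeriv hτ
  have hwc : Continuous (cubicRecon τ w dw₀) := continuous_cubicRecon hτ
  have hwS : ∀ t ∈ Icc 0 (N * τ), SolvesSE C (cubicRecon τ g dg₀ t) (cubicRecon τ w dw₀ t) :=
    fun t ht => cubicRecon_solvesSE hCm hτ hN hw hdw₀ ht.2
  have hfI := intervalIntegrable_of_memLp_two hT hf
  have huI := intervalIntegrable_of_memLp_two hT hu.memLp
  have hu'I := intervalIntegrable_of_memLp_two hT hu'
  set η : ℝ → L2v Ω := fun t => (Dw t).1 - D t with hη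
  have hηc : Continuous η := hDwc.fst.sub hDc
  have hwd : ∀ t, HasDerivAt (fun t => (cubicRecon τ w dw₀ t).1) (Dw t).1 t := fun t =>
    (ContinuousLinearMap.fst ℝ (L2v Ω) (L2t Ω)).hasFDerivAt.comp_hasDerivAt t
      (hasDerivAt_cubicRecon hτ t)
  set Q := integratedResidual uh duh₀ g dg₀ f τ with hQ
  have hQc : ContinuousOn Q (Icc 0 (N * τ)) := continuousOn_integratedResidual hτ hfI
  set cE := CF * ‖duh₀ - u₁‖ with hcE
  have hcE0 : 0 ≤ cE := poincare_mul_norm_nonneg hΩ hCF _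
  have hcs : 0 < √cstar := Real.sqrt_pos.2 hC.pos
  have hκ0 : 0 ≤ √2 * cE * (√cstar)⁻¹ := by positivity
  have hw0 : cubicRecon τ w dw₀ 0 = w 0 := by
    simpa using cubicRecon_node (x := w) (dx₀ := dw₀) hτ 0
  -- Here `σ = ∂ₜ(u_N - u)` and `η = ∂ₜθ_N`, so that `σ + η = ∂ₜρ`; `e₁` is the error of the initial
  -- velocity and `Q` the integrated residual.
  exact energy_bound (H10 Ω) isClosed_H10 (elasticCLM hCm)
    (elasticCLM_comm hΩ hC hCm) (T := N * τ) (κ := √2 * cE * (√cstar)⁻¹) hT hκ0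
    (ρ := fun t => cubicRecon τ w dw₀ t - u t) (σ := fun t => D t - u' t) (η := η) (Q := Q)
    (r₀ := (w 0).1 - u₀.1) (e₁ := duh₀ - u₁) ((hwc.intervalIntegrable _ _).sub huI)
    (by
      filter_upwards [hu.mem_H10, ae_restrict_mem measurableSet_Ioo] with t ht htm
      exact Submodule.sub_mem _ (hwS t (Ioo_subset_Icc_self htm)).1 ht)
    ((hDc.intervalIntegrable _ _).sub hu'I) hηc hQc
    (fun t ht => by
      have hut : IntervalIntegrable u' volume 0 t := hu'I.mono_set (by
        rw [uIcc_of_le hT, uIcc_of_le ht.1]; exact Icc_subset_Icc_right ht.2)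
      have h1 : ∫ s in (0 : ℝ)..t, (D s - u' s + η s) = ∫ s in (0 : ℝ)..t, ((Dw s).1 - u' s) :=
        intervalIntegral.integral_congr fun s _ => by simp only [hη]; abel
      have h2 : ∫ s in (0 : ℝ)..t, (Dw s).1 = (cubicRecon τ w dw₀ t).1 - (w 0).1 := by
        rw [intervalIntegral.integral_eq_sub_of_hasDerivAt (fun s _ => hwd s)
          (hDwc.fst.intervalIntegrable _ _), hw0]
      rw [h1, intervalIntegral.integral_sub (hDwc.fst.intervalIntegrable _ _) hut, h2,
        Prod.fst_sub, hu1 t ht]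
      abel)
    (fun φ hφ => by
      filter_upwards [error_equation (D := D) hCm hT hfI huI hwc (continuous_cubicRecon hτ)
        hwS hφ (huw φ hφ)] with t ht
      rw [ht]
      congr 1
      simp only [hQ, integratedResidual, hD]
      abel)
    (fun v hv => by
      have h1 := elasticCLM_coercive hΩ hC hCm hv
      have h2 : ⟪duh₀ - u₁, v.1⟫_ℝ ≤ cE * ‖v.2‖ :=
        calc ⟪duh₀ - u₁, v.1⟫_ℝ ≤ ‖duh₀ - u₁‖ * ‖v.1‖ := real_inner_le_norm _ _
          _ ≤ ‖duh₀ - u₁‖ * (CF * ‖v.2‖) := by gcongr; exact hCF v hv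
          _ = cE * ‖v.2‖ := by rw [hcE]; ring
      have h3 : (√2 * cE * (√cstar)⁻¹) ^ 2 = 2 * cE ^ 2 / cstar := by
        rw [mul_pow, mul_pow, inv_pow, Real.sq_sqrt hC.pos.le, Real.sq_sqrt (by norm_num)]
        ring
      -- Young's inequality with the weight that matches the Korn constant `cstar / 2`; it
      -- determines `κ² = 2 cE² / cstar`.
      have h4 : 2 * (cE * ‖v.2‖) ≤ cstar / 2 * ‖v.2‖ ^ 2 + 2 * cE ^ 2 / cstar := by
        have h5 : cstar / 2 * ‖v.2‖ ^ 2 + 2 * cE ^ 2 / cstar - 2 * (cE * ‖v.2‖)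
            = (cstar * ‖v.2‖ - 2 * cE) ^ 2 / (2 * cstar) := by
          have := hC.pos.ne'
          field_simp
          ring
        have h6 : 0 ≤ (cstar * ‖v.2‖ - 2 * cE) ^ 2 / (2 * cstar) :=
          div_nonneg (sq_nonneg _) (by linarith [hC.pos])
        linarith
      rw [h3]
      linarith)

theorem zetaMC_add_zetaEvo_nonneg {X : Type*} [NormedAddCommGroup X] [NormedSpace ℝ X]
    (𝒯 : ℕ → Mesh Ω) (r : ℕ) {τ : ℝ} (hτ : 0 < τ) (N : ℕ) (uh : ℕ → L2v Ω) (duh₀ : L2v Ω)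
    (g : ℕ → X) (dg₀ : X) : 0 ≤ zetaMC 𝒯 r τ N uh duh₀ + zetaEvo τ N g dg₀ := by
  refine add_nonneg (add_nonneg (Finset.sum_nonneg fun n _ => ?_)
    (Finset.sum_nonneg fun n hn => ?_)) ?_
  · exact intervalIntegral.integral_nonneg (by nlinarith) fun _ _ => norm_nonneg _
  · have : (n : ℝ) ≤ N := by exact_mod_cast (Finset.mem_range.1 hn).le
    exact mul_nonneg (sub_nonneg.2 (by gcongr)) (norm_nonneg _)
  · exact intervalIntegral.integral_nonneg (by positivity) fun _ _ => norm_nonneg _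

/-- The bound of the reconstruction error by the indicators. -/
theorem norm_recon_sub_le (hΩ : IsOpen Ω)
    {C : E d → Ten4 d} {cstar : ℝ} (hC : IsStiffness Ω C cstar)
    {CF : ℝ} (hCF : ∀ v ∈ H10 Ω, ‖v.1‖ ≤ CF * ‖v.2‖)
    {N : ℕ} (hN : 1 ≤ N) {τ : ℝ} (hτ : 0 < τ)
    {f : ℝ → L2v Ω} (hf : MemLp f 2 (volume.restrict (Ioo 0 (N * τ))))
    {u₀ : GradPair Ω} {u₁ : L2v Ω}
    {u : ℝ → GradPair Ω} (hu : IsWeakSolution C (N * τ) f u₀ u₁ u)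
    {𝒯 : ℕ → Mesh Ω} {r : ℕ} {α : ℝ}
    (hCT : ∀ n ≤ N, ∀ K ∈ (𝒯 n).elements, ∀ x ∈ K, ∀ y ∈ K, C x = C y)
    {uh : ℕ → L2v Ω} {duh₀ : L2v Ω} (huh : IsDiscreteSolution 𝒯 r C α τ N f u₀.1 u₁ uh duh₀)
    {w : ℕ → GradPair Ω} (hw : ∀ n ≤ N, SolvesSE C (reconData 𝒯 r C α τ f uh n) (w n))
    {dw₀ : GradPair Ω} (hdw₀ : SolvesSE C (reconData₀ 𝒯 r C α f duh₀) dw₀)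
    {θ : ℝ → L2v Ω} (hθ : ∀ t, θ t = (cubicRecon τ w dw₀ t).1 - cubicRecon τ uh duh₀ t) :
    ∀ t ∈ Icc 0 (N * τ), ‖(cubicRecon τ w dw₀ t - u t).1‖ ≤
        √2 * ‖θ 0‖ + 2 * (∫ t in (0 : ℝ)..(N * τ), ‖deriv θ t‖)
          + 2 * (zetaMC 𝒯 r τ N uh duh₀
            + zetaEvo τ N (reconData 𝒯 r C α τ f uh) (reconData₀ 𝒯 r C α f duh₀)
            + zetaOsc τ N f + zetaTRec τ N uh duh₀)
          + √2 * ‖u₀.1 - uh 0‖ + 2 * CF * (√cstar)⁻¹ * ‖u₁ - duh₀‖ := by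
  have hT : (0 : ℝ) ≤ N * τ := by positivity
  set g := reconData 𝒯 r C α τ f uh
  set dg₀ := reconData₀ 𝒯 r C α f duh₀
  set D := cubicReconDeriv uh duh₀ τ with hD
  set Dw := cubicReconDeriv w dw₀ τ with hDw
  have hDc : Continuous D := continuous_cubicReconDeriv hτ
  have hDwc : Continuous Dw := continuous_cubicReconDeriv hτ
  have hfI := intervalIntegrable_of_memLp_two hT hf
  set η : ℝ → L2v Ω := fun t => (Dw t).1 - D t with hη
  have hηc : Continuous η := hDwc.fst.sub hDc
  have hθd : ∀ t, deriv θ t = η t := fun t => by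
    have h1 : HasDerivAt θ (η t) t := by
      rw [funext hθ]
      exact ((ContinuousLinearMap.fst ℝ (L2v Ω) (L2t Ω)).hasFDerivAt.comp_hasDerivAt t
        (hasDerivAt_cubicRecon hτ t)).sub (hasDerivAt_cubicRecon hτ t)
    exact h1.deriv
  set Q := integratedResidual uh duh₀ g dg₀ f τ with hQ
  have hQc : ContinuousOn Q (Icc 0 (N * τ)) := continuousOn_integratedResidual hτ hfI
  set cE := CF * ‖duh₀ - u₁‖ with hcE
  have hcE0 : 0 ≤ cE := poincare_mul_norm_nonneg hΩ hCF _
  have hcs : 0 < √cstar := Real.sqrt_pos.2 hC.pos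
  have hw0 : cubicRecon τ w dw₀ 0 = w 0 := by
    simpa using cubicRecon_node (x := w) (dx₀ := dw₀) hτ 0
  have hu0 : cubicRecon τ uh duh₀ 0 = uh 0 := by
    simpa using cubicRecon_node (x := uh) (dx₀ := duh₀) hτ 0
  intro t ht
  refine (norm_recon_sub_le_residual hΩ hC hCF hN hτ hf hu hCT hw hdw₀ t ht).trans ?_
  -- The discrete initial velocity is itself a projection onto `V_h⁰`, so the integrated residual
  -- starts without a projection error.
  have hh0 : (dgSpace (𝒯 0) r).starProjection duh₀ = duh₀ :=
    Submodule.starProjection_eq_self_iff.2 (by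
      rw [huh.init_deriv]; exact Submodule.starProjection_apply_mem _ _)
  have hres := integral_norm_integratedResidual_le (x := uh) (dx₀ := duh₀) (g := g) (dg₀ := dg₀)
    (Pr := fun n => (dgSpace (𝒯 n) r).starProjection) hτ hfI
    (intervalIntegrable_norm_sq_of_memLp_two hT hf) (fun n v => norm_proj_le (𝒯 n) r v)
    (fun n hn => reconData_succ huh hn) hh0
  have hMC : zetaMC 𝒯 r τ N uh duh₀ = (∑ n ∈ Finset.Icc 1 N, ∫ t in (((n : ℝ) - 1) * τ)..(n * τ),
        ‖D t - (dgSpace (𝒯 n) r).starProjection (D t)‖)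
      + ∑ n ∈ Finset.range N, (N * τ - n * τ) *
          ‖(dgSpace (𝒯 (n + 1)) r).starProjection (bdiff τ uh duh₀ n)
            - (dgSpace (𝒯 n) r).starProjection (bdiff τ uh duh₀ n)‖ := by
    simp only [zetaMC, proj, (hasDerivAt_cubicRecon hτ _).deriv, hD]
  rw [← hMC] at hres
  have hQI : IntervalIntegrable (fun s => ‖Q s‖) volume 0 (N * τ) :=
    ContinuousOn.intervalIntegrable (by rw [uIcc_of_le hT]; exact hQc.norm)
  have hηI : IntervalIntegrable (fun s => ‖η s‖) volume 0 (N * τ) :=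
    hηc.norm.intervalIntegrable _ _
  have hQηc : ContinuousOn (fun s => ‖Q s + η s‖) (Icc 0 (N * τ)) :=
    (hQc.add hηc.continuousOn).norm
  have hQηI : IntervalIntegrable (fun s => ‖Q s + η s‖) volume 0 (N * τ) :=
    ContinuousOn.intervalIntegrable (by rwa [uIcc_of_le hT])
  have h1 : ∫ s in (0 : ℝ)..t, ‖Q s + η s‖ ≤ ∫ s in (0 : ℝ)..(N * τ), ‖Q s + η s‖ :=
    intervalIntegral.integral_mono_interval le_rfl ht.1 ht.2
      (Eventually.of_forall fun _ => norm_nonneg _) hQηI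
  have h2 : ∫ s in (0 : ℝ)..(N * τ), ‖Q s + η s‖
      ≤ (∫ s in (0 : ℝ)..(N * τ), ‖Q s‖) + ∫ s in (0 : ℝ)..(N * τ), ‖η s‖ := by
    rw [← intervalIntegral.integral_add hQI hηI]
    exact intervalIntegral.integral_mono_on hT hQηI (hQI.add hηI) fun s _ => norm_add_le _ _
  have h3 : 0 ≤ ∫ s in (0 : ℝ)..(N * τ), ‖Q s‖ :=
    intervalIntegral.integral_nonneg hT fun _ _ => norm_nonneg _
  have h4 : 0 ≤ ∫ s in (0 : ℝ)..(N * τ), ‖η s‖ :=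
    intervalIntegral.integral_nonneg hT fun _ _ => norm_nonneg _
  have h5 : ‖(w 0).1 - u₀.1‖ ≤ ‖θ 0‖ + ‖u₀.1 - uh 0‖ := by
    rw [hθ, hw0, hu0]
    have h6 : (w 0).1 - u₀.1 = ((w 0).1 - uh 0) - (u₀.1 - uh 0) := by abel
    rw [h6]
    exact norm_sub_le _ _
  -- From here the constants are only enlarged: `1` to `√2` for the initial displacement terms, `√2`
  -- to `2` for the initial velocity, and `1` to `2` for `∂ₜθ_N`, mesh change and evolution, all of
  -- which are nonnegative.
  have hs2 : 1 ≤ √2 := Real.one_le_sqrt.2 (by norm_num)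
  have hs2' : √2 ≤ 2 := Real.sqrt_le_iff.2 ⟨by norm_num, by norm_num⟩
  have h7 : √2 * cE * (√cstar)⁻¹ ≤ 2 * CF * (√cstar)⁻¹ * ‖u₁ - duh₀‖ := by
    calc √2 * cE * (√cstar)⁻¹ ≤ 2 * cE * (√cstar)⁻¹ := by gcongr
      _ = _ := by rw [hcE, norm_sub_rev]; ring
  have h8 : ‖θ 0‖ ≤ √2 * ‖θ 0‖ := le_mul_of_one_le_left (norm_nonneg _) hs2
  have h9 : ‖u₀.1 - uh 0‖ ≤ √2 * ‖u₀.1 - uh 0‖ := le_mul_of_one_le_left (norm_nonneg _) hs2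
  have h10 : 0 ≤ zetaMC 𝒯 r τ N uh duh₀ + zetaEvo τ N g dg₀ :=
    zetaMC_add_zetaEvo_nonneg 𝒯 r hτ N uh duh₀ g dg₀
  simp only [hθd]
  linarith

end ElastoDG

/-! ### The main theorem. -/

open ElastoDG MeasureTheory Set in
theorem mainTheorem2 {d : ℕ} (Ω : Set (E d)) (hΩ : IsOpen Ω)
    (C : E d → Ten4 d) (cstar : ℝ) (hC : IsStiffness Ω C cstar)
    (CF : ℝ) (hCF : ∀ v ∈ H10 Ω, ‖v.1‖ ≤ CF * ‖v.2‖)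
    (N : ℕ) (hN : 1 ≤ N) (τ : ℝ) (hτ : 0 < τ)
    (f : ℝ → L2v Ω) (hf : MemLp f 2 (volume.restrict (Ioo 0 (N * τ))))
    (u₀ : GradPair Ω) (hu₀ : u₀ ∈ H10 Ω) (u₁ : L2v Ω)
    (u : ℝ → GradPair Ω) (hu : IsWeakSolution C (N * τ) f u₀ u₁ u)
    (𝒯 : ℕ → Mesh Ω) (r : ℕ) (α : ℝ) (hα : 0 < α)
    (hCT : ∀ n ≤ N, ∀ K ∈ (𝒯 n).elements, ∀ x ∈ K, ∀ y ∈ K, C x = C y)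
    (uh : ℕ → L2v Ω) (duh₀ : L2v Ω)
    (huh : IsDiscreteSolution 𝒯 r C α τ N f u₀.1 u₁ uh duh₀)
    (w : ℕ → GradPair Ω) (hw : ∀ n ≤ N, SolvesSE C (reconData 𝒯 r C α τ f uh n) (w n))
    (dw₀ : GradPair Ω) (hdw₀ : SolvesSE C (reconData₀ 𝒯 r C α f duh₀) dw₀)
    (uN : ℝ → L2v Ω) (huN : uN = cubicRecon τ uh duh₀)
    (wN : ℝ → GradPair Ω) (hwN : wN = cubicRecon τ w dw₀)
    (e θ : ℝ → L2v Ω) (he : ∀ t, e t = uN t - (u t).1) (hθ : ∀ t, θ t = (wN t).1 - uN t) :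
    eLpNorm e ⊤ (volume.restrict (Ioo 0 (N * τ))) ≤
      eLpNorm θ ⊤ (volume.restrict (Ioo 0 (N * τ))) + ENNReal.ofReal
        (√2 * ‖θ 0‖ + 2 * (∫ t in (0 : ℝ)..(N * τ), ‖deriv θ t‖)
          + 2 * (zetaMC 𝒯 r τ N uh duh₀
            + zetaEvo τ N (reconData 𝒯 r C α τ f uh) (reconData₀ 𝒯 r C α f duh₀)
            + zetaOsc τ N f + zetaTRec τ N uh duh₀)
          + √2 * ‖u₀.1 - uh 0‖ + 2 * CF * (√cstar)⁻¹ * ‖u₁ - duh₀‖) := by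
  have hbound := norm_recon_sub_le hΩ hC hCF hN hτ hf hu hCT huh hw hdw₀ (θ := θ)
    fun t => by rw [hθ, hwN, huN]
  -- The splitting `e_N = ρ - θ_N`: the bound of `ρ` holds at every time, and `θ_N` enters through
  -- its own `L^∞` norm.
  have hee : e = (fun t => (wN t - u t).1) - θ := by
    funext t
    rw [Pi.sub_apply, he, hθ, Prod.fst_sub]
    abel
  have hwc : Continuous wN := by rw [hwN]; exact continuous_cubicRecon hτ
  have huc : Continuous uN := by rw [huN]; exact continuous_cubicRecon hτ
  have hθc : Continuous θ := by
    rw [funext hθ]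
    exact hwc.fst.sub huc
  have : SecondCountableTopologyEither ℝ (GradPair Ω) := ⟨Or.inl inferInstance⟩
  have hρm : AEStronglyMeasurable (fun t => (wN t - u t).1)
      (volume.restrict (Ioo 0 (N * τ))) :=
    continuous_fst.comp_aestronglyMeasurable
      (hwc.aestronglyMeasurable.sub hu.memLp.aestronglyMeasurable)
  rw [hee]
  refine (eLpNorm_sub_le hρm hθc.aestronglyMeasurable le_top).trans ?_
  rw [add_comm]
  gcongr
  rw [eLpNorm_exponent_top]
  refine eLpNormEssSup_le_of_ae_bound ?_
  filter_upwards [ae_restrict_mem measurableSet_Ioo] with t ht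
  rw [hwN]
  exact hbound t (Ioo_subset_Icc_self ht)
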